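/- Let $T>0$, let $B=(B_t)_{t\in[0,T]}$ and $W=(W_t)_{t\in[0,T]}$ be independent standard Brownian motions on a probability space, and let $\sigma:[0,T]\to\mathbb R$ be a deterministic measurable function with $\int_0^T\sigma_s^2\,ds<\infty$. Let $V$ be the continuous version of $$V_t=B_T+\int_t^T\sigma_s\,dW_s,\qquad 0\le t\le T,$$ where the integral is a Wiener integral, and let $\mathbb F^{B,V}$ be the filtration generated by $B$ and $V$, augmented by the null events and made right-continuous: $$\mathcal F^{B,V}_t=\bigcap_{t<s\le T}\big(\sigma(B_u,V_u:u\le s)\vee\mathcal N\big)\ (t<T),\qquad \mathcal F^{B,V}_T=\sigma(B_u,V_u:u\le T)\vee\mathcal N .$$ Assume that $$\int_0^t\frac{T}{T+\int_s^T\sigma_u^2\,du-s}\,ds<\infty\qquad\text{for all }0\le t<T .$$ Then there is a process $\tilde W=(\tilde W_t)_{t\in[0,T]}$ that is a standard Brownian motion with respect to $\mathbb F^{B,V}$ and such that, almost surely, for all $0\le t\le T$, $$B_t=\tilde W_t+\int_0^t\frac{V_s-B_s}{T+\int_s^T\sigma_u^2\,du-s}\,ds ,$$ where the integral converges absolutely.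 This is the Doob–Meyer decomposition of $B$ in $\mathbb F^{B,V}$: $\tilde W$ is a continuous $\mathbb F^{B,V}$-martingale, and the integral term is (indistinguishable from) a continuous $\mathbb F^{B,V}$-adapted process of finite variation that starts at $0$. Moreover $\tilde W$ is correlated with $V$ unless $\sigma$ vanishes: $\operatorname{Cov}(\tilde W_t,V_s)>0$ for all $0\le s\le t\le T$ such that $\sigma$ is not a.e. zero on $[0,s]$ (in particular for $s=t=T$ if $\sigma$ is not a.e. zero on $[0,T]$). In contrast, if $\sigma=0$ a.e. on $[0,T]$, so that $V_t=B_T$ (initial enlargement by $B_T$), then the process $\tilde W$ is independent of $B_T$. -/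

import Mathlib

open MeasureTheory ProbabilityTheory Filter Topology

namespace Enlargement

/-- The time set `[0, T]`. It carries the restriction of Lebesgue measure as `volume`. -/
abbrev Time (T : ℝ) : Type := Set.Icc (0 : ℝ) T

/-- The final time `T`, as an element of `[0, T]`. -/
def finalTime {T : ℝ} (hT : 0 < T) : Time T := ⟨T, hT.le, le_rfl⟩

variable {Ω : Type*} [mΩ : MeasurableSpace Ω] {T : ℝ}

/-- A standard real Brownian motion `(X t)`, `t ∈ [0, T]`. -/
structure IsBrownianMotion (X : Time T → Ω → ℝ) (P : Measure Ω) : Prop where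
  measurable : ∀ t, Measurable (X t)
  zero : ∀ t : Time T, (t : ℝ) = 0 → ∀ᵐ ω ∂P, X t ω = 0
  hasIndepIncrements : HasIndepIncrements X P
  hasLaw_sub : ∀ s t : Time T, s ≤ t →
    HasLaw (X t - X s) (gaussianReal 0 ((t : ℝ) - (s : ℝ)).toNNReal) P
  continuous : ∀ᵐ ω ∂P, Continuous fun t ↦ X t ω

/-- A standard real Brownian motion on `[0, T]` relative to the filtration `𝓖`: it is adapted to
`𝓖`, and the increments after time `s` are independent of `𝓖 s`. -/
structure IsBrownianMotionWrt (𝓖 : Filtration (Time T) mΩ) (X : Time T → Ω → ℝ)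
    (P : Measure Ω) : Prop extends IsBrownianMotion X P where
  adapted : ∀ t, Measurable[𝓖 t] (X t)
  indep : ∀ s t : Time T, s ≤ t →
    Indep (MeasurableSpace.comap (X t - X s) inferInstance) (𝓖 s) P

/-- The σ-algebra generated by the events of probability zero. -/
@[reducible] def nullSigma (P : Measure Ω) : MeasurableSpace Ω :=
  MeasurableSpace.generateFrom {N | MeasurableSet N ∧ P N = 0}

lemma nullSigma_le (P : Measure Ω) : nullSigma P ≤ mΩ :=
  MeasurableSpace.generateFrom_le fun _ h ↦ h.1

/-- The filtration `𝔽^{X,Y}` generated by two processes, augmented by the null events and made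
right-continuous: its value at `t < T` is `⋂ s > t, σ(X u, Y u, u ≤ s) ∨ σ(null events)`, and
its value at `T` is `σ(X u, Y u, u ≤ T) ∨ σ(null events)`. -/
noncomputable def jointFiltration (X Y : Time T → Ω → ℝ) (hX : ∀ t, Measurable (X t))
    (hY : ∀ t, Measurable (Y t)) (P : Measure Ω) : Filtration (Time T) mΩ :=
  (Filtration.natural X (fun t ↦ (hX t).stronglyMeasurable) ⊔
    Filtration.natural Y (fun t ↦ (hY t).stronglyMeasurable) ⊔
    Filtration.const (Time T) (nullSigma P) (nullSigma_le P)).rightCont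

/-- A deterministic step function `∑ i, c i * 1_{(a i, b i]}` on `[0, T]`. -/
structure StepFunction (T : ℝ) where
  n : ℕ
  coeff : Fin n → ℝ
  left : Fin n → Time T
  right : Fin n → Time T
  left_le_right : ∀ i, left i ≤ right i

/-- The step function as a function of time. -/
noncomputable def StepFunction.eval (φ : StepFunction T) (s : ℝ) : ℝ :=
  ∑ i, φ.coeff i * (Set.Ioc (φ.left i : ℝ) (φ.right i : ℝ)).indicator 1 s

/-- The elementary integral `∫₀ᵀ φ dW = ∑ i, c i * (W (b i) - W (a i))`. -/
def StepFunction.integral (φ : StepFunction T) (W : Time T → Ω → ℝ) (ω : Ω) : ℝ :=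
  ∑ i, φ.coeff i * (W (φ.right i) ω - W (φ.left i) ω)

/-- `X` is a version of the Wiener integral `∫₀ᵀ f dW` of the deterministic function `f`: it is the
limit in `L²(P)` of the elementary integrals of step functions that converge to `f` in
`L²([0, T])`. (When `W` is a Brownian motion the elementary integral is an isometry, so `X` is
almost surely unique, and does not depend on the approximating step functions.) -/
def IsWienerIntegral (W : Time T → Ω → ℝ) (P : Measure Ω) (f : ℝ → ℝ) (X : Ω → ℝ) : Prop :=
  MemLp X 2 P ∧ ∃ φ : ℕ → StepFunction T,
    Tendsto (fun n ↦ eLpNorm (fun s ↦ f s - (φ n).eval s) 2 (volume.restrict (Set.Icc 0 T)))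
      atTop (𝓝 0) ∧
    Tendsto (fun n ↦ eLpNorm (fun ω ↦ X ω - (φ n).integral W ω) 2 P) atTop (𝓝 0)

/-- `X` is (the continuous version of) the process `t ↦ Z + ∫ₜᵀ σ s dW s` on `[0, T]`. -/
structure IsBackwardWienerProcess (W : Time T → Ω → ℝ) (P : Measure Ω) (σ : ℝ → ℝ) (Z : Ω → ℝ)
    (X : Time T → Ω → ℝ) : Prop where
  measurable : ∀ t, Measurable (X t)
  isWienerIntegral : ∀ t : Time T,
    IsWienerIntegral W P ((Set.Ioc (t : ℝ) T).indicator σ) (fun ω ↦ X t ω - Z ω)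
  continuous : ∀ᵐ ω ∂P, Continuous fun t ↦ X t ω

/-- `X = M + A` is the Doob–Meyer decomposition of the continuous process `X` in the filtration
`𝓖`: `M` is a continuous `𝓖`-martingale, and `A` is a continuous `𝓖`-adapted process of finite
variation that starts at zero. -/
structure IsDoobMeyerDecomposition (𝓖 : Filtration (Time T) mΩ) (P : Measure Ω)
    (X M A : Time T → Ω → ℝ) : Prop where
  eq_add : ∀ᵐ ω ∂P, ∀ t, X t ω = M t ω + A t ω
  martingale : Martingale M 𝓖 P
  continuous_martingale : ∀ᵐ ω ∂P, Continuous fun t ↦ M t ω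
  adapted : ∀ t, Measurable[𝓖 t] (A t)
  continuous : ∀ᵐ ω ∂P, Continuous fun t ↦ A t ω
  zero : ∀ t : Time T, (t : ℝ) = 0 → ∀ᵐ ω ∂P, A t ω = 0
  boundedVariation : ∀ᵐ ω ∂P, BoundedVariationOn (fun t ↦ A t ω) Set.univ

/-- The variance `T + ∫ₛᵀ (σ u)² du - s` of `V s - B s`, where `V s = B T + ∫ₛᵀ σ u dW u`. -/
noncomputable def signalVar (T : ℝ) (σ : ℝ → ℝ) (s : ℝ) : ℝ :=
  T + (∫ u in s..T, σ u ^ 2) - s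

/-- For paths `v` and `b` on `[0, T]`, the function `s ↦ (v s - b s) / (T + ∫ₛᵀ (σ u)² du - s)`.
(The paths are extended to real times outside `[0, T]` by constants, only to have a function on
the reals; these times play no role.) -/
noncomputable def driftRate (hT : 0 < T) (σ : ℝ → ℝ) (v b : Time T → ℝ) (s : ℝ) : ℝ :=
  (Set.IccExtend hT.le v s - Set.IccExtend hT.le b s) / signalVar T σ s

end Enlargement

/-! Write g(s) for the integral of σ² over [s, T] and Y = V - B. All variables involved lie in one
closed Gaussian subspace of L²(P), where orthogonality is independence, so the theorem becomes a
computation with the curves b, v of B, V in a Hilbert space. The covariances needed are ⟨b_s, b_t⟩ =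
min(s, t), ⟨b_s, v_t⟩ = s and ⟨v_s, v_t⟩ = T + g(max(s, t)); they are collected in `IsSignalPair`.

For u ≤ r, Y_r is orthogonal to b_u, while ⟨v_u, Y_r⟩ = T + g(r) - r = ‖Y_r‖² does not depend on u.
Hence Y_r / ‖Y_r‖² has inner product 0 with b_u and 1 with v_u. An increment b_t - b_s with s ≥ u
has inner products 0 and t - s with them, so subtracting the integrated rate leaves a vector
orthogonal to the past of both curves (`inner_b_innovation_sub`, `inner_v_innovation_sub`). An
integration by parts shows that its squared norm is still t - s (`inner_innovation_sub_self`). The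
rate has norm at most (T - r)^(-1/2), so its integral converges up to the final time. The covariance
of the innovation with v_s is the integral of (g(r) - g(s)) / (T + g(r) - r) over [0, s], which
gives the positivity; if g(0) = 0, then b_T = v_0 already belongs to the past at time 0, which gives
the independence.

To return to processes, `coeFn_integral_Lp` identifies the Bochner integral in L² with the pathwise
integral, `IsGaussianSpace.indepFun` turns orthogonality into independence, and
`indep_sup_nullSigma` and `indep_jointFiltration` pass to the augmented right-continuous filtration.
-/

namespace Enlargement

/-! ### Gaussian subspaces of L²: orthogonality and independence. -/

section GaussianSpace

variable {Ω : Type*} [mΩ : MeasurableSpace Ω] {P : Measure Ω}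

/-- A subspace of `L²(P)` all of whose elements are centred Gaussian random variables. -/
def IsGaussianSpace (G : Submodule ℝ (Lp ℝ 2 P)) : Prop :=
  ∀ x ∈ G, P.map x = gaussianReal 0 (‖x‖ ^ 2).toNNReal

lemma Lp.aemeasurable (x : Lp ℝ 2 P) : AEMeasurable x P :=
  (Lp.aestronglyMeasurable x).aemeasurable

lemma inner_eq_integral {x y : Lp ℝ 2 P} {X Y : Ω → ℝ} (hx : x =ᵐ[P] X) (hy : y =ᵐ[P] Y) :
    inner ℝ x y = ∫ ω, X ω * Y ω ∂P := by
  rw [L2.inner_def]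
  refine integral_congr_ae ?_
  filter_upwards [hx, hy] with ω h₁ h₂
  simp [h₁, h₂, mul_comm]

lemma map_eq_gaussianReal_of_hasGaussianLaw {x : Lp ℝ 2 P} (hx : HasGaussianLaw x P)
    (h0 : ∫ ω, x ω ∂P = 0) : P.map x = gaussianReal 0 (‖x‖ ^ 2).toNNReal := by
  rw [hx.map_eq_gaussianReal, h0, variance_of_integral_eq_zero (Lp.aemeasurable x) h0,
    ← real_inner_self_eq_norm_sq, inner_eq_integral (EventuallyEq.refl _ _) (EventuallyEq.refl _ _)]
  simp [pow_two]

lemma charFun_gaussianReal_zero_norm_sq (x : Lp ℝ 2 P) (t : ℝ) :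
    charFun (gaussianReal 0 (‖x‖ ^ 2).toNNReal) t =
      Complex.exp (-((‖x‖ ^ 2 * t ^ 2 / 2 : ℝ) : ℂ)) := by
  rw [charFun_gaussianReal]
  congr 1
  have : (((‖x‖ ^ 2).toNNReal : ℝ) : ℂ) = ((‖x‖ ^ 2 : ℝ) : ℂ) := by
    rw [Real.coe_toNNReal _ (by positivity)]
  rw [this]
  push_cast
  ring

lemma IsGaussianSpace.integral_eq_zero {G : Submodule ℝ (Lp ℝ 2 P)} (hG : IsGaussianSpace G)
    {x : Lp ℝ 2 P} (hx : x ∈ G) : ∫ ω, x ω ∂P = 0 := by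
  have h := integral_map (μ := P) (Lp.aemeasurable x) (f := fun y : ℝ ↦ y)
    (by fun_prop)
  rw [hG x hx, integral_id_gaussianReal] at h
  exact h.symm

lemma IsGaussianSpace.hasLaw {G : Submodule ℝ (Lp ℝ 2 P)} (hG : IsGaussianSpace G)
    {x : Lp ℝ 2 P} (hx : x ∈ G) {X : Ω → ℝ} (hX : x =ᵐ[P] X) {v : ℝ} (hv : inner ℝ x x = v) :
    HasLaw X (gaussianReal 0 v.toNNReal) P where
  aemeasurable := (Lp.aemeasurable x).congr hX
  map_eq := by
    rw [← Measure.map_congr hX, hG x hx, ← hv, real_inner_self_eq_norm_sq]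

/-- Convergence in L² implies convergence in distribution, and the characteristic function of a
centred Gaussian depends continuously on its norm in L². -/
lemma IsGaussianSpace.topologicalClosure [IsProbabilityMeasure P]
    {G : Submodule ℝ (Lp ℝ 2 P)} (hG : IsGaussianSpace G) :
    IsGaussianSpace G.topologicalClosure := by
  intro x hx
  rw [← SetLike.mem_coe, Submodule.topologicalClosure_coe, mem_closure_iff_seq_limit] at hx
  obtain ⟨u, hu, hlim⟩ := hx
  have := Measure.isProbabilityMeasure_map (μ := P) (Lp.aemeasurable x)
  refine Measure.ext_of_charFun (funext fun t ↦ ?_)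
  have hd : TendstoInDistribution (fun n ↦ (u n : Ω → ℝ)) atTop x (fun _ ↦ P) P :=
    (tendstoInMeasure_of_tendsto_Lp hlim).tendstoInDistribution fun n ↦ Lp.aemeasurable _
  have h1 := ProbabilityMeasure.tendsto_iff_tendsto_charFun.1 hd.tendsto t
  simp only [ProbabilityMeasure.coe_mk] at h1
  refine tendsto_nhds_unique h1 ?_
  simp only [fun n ↦ hG (u n) (hu n), charFun_gaussianReal_zero_norm_sq]
  have hc : Continuous fun r : ℝ ↦ Complex.exp (-((r ^ 2 * t ^ 2 / 2 : ℝ) : ℂ)) := by fun_prop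
  exact (hc.tendsto _).comp ((continuous_norm.tendsto x).comp hlim)

lemma IsGaussianSpace.covariance_eq [IsProbabilityMeasure P]
    {G : Submodule ℝ (Lp ℝ 2 P)} (hG : IsGaussianSpace G)
    {x y : Lp ℝ 2 P} (hx : x ∈ G) {X Y : Ω → ℝ} (hX : x =ᵐ[P] X) (hY : y =ᵐ[P] Y) :
    cov[X, Y; P] = inner ℝ x y := by
  rw [covariance_eq_sub ((memLp_congr_ae hX).1 (Lp.memLp x)) ((memLp_congr_ae hY).1 (Lp.memLp y)),
    ← integral_congr_ae hX, hG.integral_eq_zero hx, inner_eq_integral hX hY]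
  simp

/-- Any linear functional of finitely many coordinates is represented by a linear combination in
`G`, hence is Gaussian; this characterises joint Gaussianity. -/
lemma IsGaussianSpace.isGaussianProcess {G : Submodule ℝ (Lp ℝ 2 P)} (hG : IsGaussianSpace G)
    {S : Type*} {X : S → Ω → ℝ} (hX : ∀ s, ∃ x ∈ G, x =ᵐ[P] X s) : IsGaussianProcess X P := by
  classical
  choose x hxG hx using hX
  refine ⟨fun I ↦ ⟨⟨fun L ↦ ?_⟩⟩⟩
  have hm : AEMeasurable (fun ω ↦ I.restrict (X · ω)) P :=
    aemeasurable_pi_lambda _ fun i ↦ (Lp.aemeasurable (x i)).congr (hx i)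
  have key : (∑ i : I, L (Pi.single i 1) • x i : Lp ℝ 2 P) =ᵐ[P]
      fun ω ↦ L (I.restrict (X · ω)) := by
    have h1 : ∀ᵐ ω ∂P, ∀ i : I, x i ω = X i ω := ae_all_iff.2 fun i ↦ hx i
    have h2 : ∀ᵐ ω ∂P, ∀ i : I, (L (Pi.single i 1) • x i : Lp ℝ 2 P) ω =
        L (Pi.single i 1) * x i ω := ae_all_iff.2 fun i ↦ Lp.coeFn_smul _ _
    filter_upwards [h1, h2, Lp.coeFn_finsetSum Finset.univ
      (fun i : I ↦ L (Pi.single i 1) • x i)] with ω h1 h2 h3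
    rw [h3, Finset.sum_apply]
    simp only [h2, h1]
    conv_rhs => rw [← Finset.univ_sum_single (I.restrict (X · ω)), map_sum]
    refine Finset.sum_congr rfl fun i _ ↦ ?_
    have : (Pi.single i (I.restrict (X · ω) i) : I → ℝ) = X i ω • Pi.single i (1 : ℝ) := by
      rw [← Pi.single_smul]; simp
    rw [this, map_smul, smul_eq_mul, mul_comm]
  have hmem : (∑ i : I, L (Pi.single i 1) • x i : Lp ℝ 2 P) ∈ G :=
    G.sum_mem fun i _ ↦ G.smul_mem _ (hxG i)
  have hlaw : HasGaussianLaw (fun ω ↦ L (I.restrict (X · ω))) P :=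
    (hG.hasLaw hmem key rfl).hasGaussianLaw
  have h := hlaw.map_eq_gaussianReal
  rw [AEMeasurable.map_map_of_aemeasurable (by fun_prop) hm,
    integral_map hm (by fun_prop), variance_map (by fun_prop) hm]
  exact h

/-- Orthogonal families in a Gaussian space are independent. -/
lemma IsGaussianSpace.indepFun [IsProbabilityMeasure P]
    {G : Submodule ℝ (Lp ℝ 2 P)} (hG : IsGaussianSpace G)
    {S S' : Type*} {X : S → Ω → ℝ} {Y : S' → Ω → ℝ} {x : S → Lp ℝ 2 P} {y : S' → Lp ℝ 2 P}
    (hxG : ∀ s, x s ∈ G) (hyG : ∀ s, y s ∈ G) (hX : ∀ s, x s =ᵐ[P] X s) (hY : ∀ s, y s =ᵐ[P] Y s)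
    (h : ∀ s s', inner ℝ (x s) (y s') = 0) :
    IndepFun (fun ω s ↦ X s ω) (fun ω s ↦ Y s ω) P := by
  refine IsGaussianProcess.indepFun_of_covariance_eq_zero (hG.isGaussianProcess ?_)
    (fun s ↦ (Lp.aemeasurable _).congr (hX s)) (fun s ↦ (Lp.aemeasurable _).congr (hY s))
    fun s s' ↦ by rw [hG.covariance_eq (hxG s) (hX s) (hY s'), h]
  rintro (s | s)
  · exact ⟨x s, hxG s, hX s⟩
  · exact ⟨y s, hyG s, hY s⟩

/-- Increments are jointly Gaussian, so pairwise orthogonality makes them mutually independent. -/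
lemma IsGaussianSpace.hasIndepIncrements [IsProbabilityMeasure P]
    {G : Submodule ℝ (Lp ℝ 2 P)} (hG : IsGaussianSpace G)
    {S : Type*} [Preorder S] {X : S → Ω → ℝ} {x : S → Lp ℝ 2 P} (hxG : ∀ s, x s ∈ G)
    (hX : ∀ s, x s =ᵐ[P] X s)
    (h : ∀ r s t u, r ≤ s → s ≤ t → t ≤ u → inner ℝ (x s - x r) (x u - x t) = 0) :
    HasIndepIncrements X P := by
  intro n t ht
  have hrep : ∀ i : Fin n, (x (t i.succ) - x (t i.castSucc) : Lp ℝ 2 P) =ᵐ[P]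
      fun ω ↦ X (t i.succ) ω - X (t i.castSucc) ω := fun i ↦ by
    filter_upwards [hX (t i.succ), hX (t i.castSucc), Lp.coeFn_sub (x (t i.succ))
      (x (t i.castSucc))] with ω h1 h2 h3
    rw [h3, Pi.sub_apply, h1, h2]
  have hmem : ∀ i : Fin n, x (t i.succ) - x (t i.castSucc) ∈ G := fun i ↦
    G.sub_mem (hxG _) (hxG _)
  refine HasGaussianLaw.iIndepFun_of_covariance_eq_zero
    ((hG.isGaussianProcess fun s ↦ ⟨x s, hxG s, hX s⟩).hasGaussianLaw_increments) fun i j hij ↦ ?_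
  rw [hG.covariance_eq (hmem i) (hrep i) (hrep j)]
  rcases lt_or_gt_of_ne hij with hij | hij
  · exact h _ _ _ _ (ht (Fin.castSucc_le_succ i)) (ht (by simpa [Fin.le_def] using hij))
      (ht (Fin.castSucc_le_succ j))
  · rw [real_inner_comm]
    exact h _ _ _ _ (ht (Fin.castSucc_le_succ j)) (ht (by simpa [Fin.le_def] using hij))
      (ht (Fin.castSucc_le_succ i))

/-- The linear span of a centred Gaussian process is a Gaussian space. -/
lemma IsGaussianProcess.isGaussianSpace_span {S : Type*} {Z : S → Ω → ℝ}
    (hZ : IsGaussianProcess Z P) (h0 : ∀ s, ∫ ω, Z s ω ∂P = 0) {z : S → Lp ℝ 2 P}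
    (hz : ∀ s, z s =ᵐ[P] Z s) : IsGaussianSpace (Submodule.span ℝ (Set.range z)) := by
  classical
  intro x hx
  obtain ⟨c, rfl⟩ := Finsupp.mem_span_range_iff_exists_finsupp.1 hx
  have hrep : (c.sum fun i a ↦ a • z i : Lp ℝ 2 P) =ᵐ[P] fun ω ↦ ∑ i ∈ c.support, c i * Z i ω := by
    have h1 : ∀ᵐ ω ∂P, ∀ i : c.support, z i ω = Z i ω := ae_all_iff.2 fun i ↦ hz i
    have h2 : ∀ᵐ ω ∂P, ∀ i : c.support, (c i • z i : Lp ℝ 2 P) ω = c i * z i ω :=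
      ae_all_iff.2 fun i ↦ Lp.coeFn_smul _ _
    filter_upwards [h1, h2, Lp.coeFn_finsetSum c.support (fun i ↦ c i • z i)] with ω h1 h2 h3
    rw [Finsupp.sum, h3, Finset.sum_apply]
    refine Finset.sum_congr rfl fun i hi ↦ ?_
    rw [h2 ⟨i, hi⟩, h1 ⟨i, hi⟩]
  refine map_eq_gaussianReal_of_hasGaussianLaw ?_ ?_
  · refine HasGaussianLaw.congr ?_ hrep.symm
    exact (hZ.comp_left fun i ↦ c i • ContinuousLinearMap.id ℝ ℝ).hasGaussianLaw_fun_sum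
  · rw [integral_congr_ae hrep, integral_finsetSum]
    · simp [integral_const_mul, h0]
    · exact fun i _ ↦ ((hZ.hasGaussianLaw_eval i).integrable).const_mul _

/-- Independent Gaussian processes are jointly Gaussian. -/
lemma IsGaussianProcess.sumElim {S S' : Type*} {X : S → Ω → ℝ} {Y : S' → Ω → ℝ}
    (hX : IsGaussianProcess X P) (hY : IsGaussianProcess Y P)
    (h : IndepFun (fun ω s ↦ X s ω) (fun ω s ↦ Y s ω) P) :
    IsGaussianProcess (Sum.elim X Y) P := by
  classical
  refine ⟨fun I ↦ ?_⟩
  have hind : IndepFun (fun ω ↦ I.toLeft.restrict (X · ω)) (fun ω ↦ I.toRight.restrict (Y · ω)) P :=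
    h.comp (Finset.measurable_restrict _) (Finset.measurable_restrict _)
  have hg := IndepFun.hasGaussianLaw (hX.hasGaussianLaw I.toLeft) (hY.hasGaussianLaw I.toRight) hind
  let L : (I.toLeft → ℝ) × (I.toRight → ℝ) →L[ℝ] (I → ℝ) := ContinuousLinearMap.pi fun i ↦
    match i with
    | ⟨.inl s, hs⟩ => (ContinuousLinearMap.proj (⟨s, by simpa using hs⟩ : I.toLeft)).comp
        (ContinuousLinearMap.fst ℝ _ _)
    | ⟨.inr s, hs⟩ => (ContinuousLinearMap.proj (⟨s, by simpa using hs⟩ : I.toRight)).comp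
        (ContinuousLinearMap.snd ℝ _ _)
  have heq : (fun ω ↦ I.restrict fun s ↦ Sum.elim X Y s ω) =
      L ∘ fun ω ↦ (I.toLeft.restrict (X · ω), I.toRight.restrict (Y · ω)) := by
    funext ω i
    rcases i with ⟨s | s, hs⟩ <;> rfl
  rw [heq]
  exact hg.map L

end GaussianSpace

/-! ### Two facts on real integrals. -/

section RealIntegrals

lemma intervalIntegral_congr_Ioo {E : Type*} [NormedAddCommGroup E] [NormedSpace ℝ E]
    {f h : ℝ → E} {s t : ℝ} (hst : s ≤ t) (hf : ∀ r ∈ Set.Ioo s t, f r = h r) :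
    ∫ r in s..t, f r = ∫ r in s..t, h r := by
  rw [intervalIntegral.integral_of_le hst, intervalIntegral.integral_of_le hst,
    integral_Ioc_eq_integral_Ioo, integral_Ioc_eq_integral_Ioo]
  exact setIntegral_congr_fun measurableSet_Ioo hf

/-- Integration by parts against r - t: one boundary term vanishes because the primitive starts at
s, the other because r - t vanishes at t. It provides the cancellation in the variance of the
innovation. -/
lemma integral_integral_eq_integral_sub_mul {h : ℝ → ℝ} {s t : ℝ} (hst : s ≤ t)
    (hc : ContinuousOn h (Set.Icc s t)) :
    ∫ r in s..t, (∫ q in s..r, h q) = ∫ r in s..t, (t - r) * h r := by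
  have hu : Set.uIcc s t = Set.Icc s t := Set.uIcc_of_le hst
  have hi : IntervalIntegrable h volume s t := (hu ▸ hc).intervalIntegrable
  have key := intervalIntegral.integral_mul_deriv_eq_deriv_mul_of_hasDeriv_right
    (a := s) (b := t) (u := fun r ↦ ∫ q in s..r, h q) (v := fun r ↦ r - t) (u' := h)
    (v' := fun _ ↦ 1)
    (intervalIntegral.continuousOn_primitive_interval
      (by rw [hu]; exact hc.integrableOn_Icc)) (by fun_prop) ?_ ?_ hi (by simp)
  · simp only [mul_one, sub_self, mul_zero, intervalIntegral.integral_same, zero_mul,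
      zero_sub] at key
    rw [key, ← intervalIntegral.integral_neg]
    congr 1
    ext r
    ring
  · intro x hx
    rw [min_eq_left hst, max_eq_right hst] at hx
    have hx' : Set.Icc s t ∈ 𝓝 x := Icc_mem_nhds hx.1 hx.2
    refine (intervalIntegral.integral_hasDerivAt_right ?_ ?_ (hc.continuousAt hx')).hasDerivWithinAt
    · refine hi.mono_set ?_
      rw [hu, Set.uIcc_of_le hx.1.le]
      exact Set.Icc_subset_Icc_right hx.2.le
    · exact ⟨Set.Icc s t, hx', hc.aestronglyMeasurable measurableSet_Icc⟩
  · exact fun x _ ↦ ((hasDerivAt_id x).sub_const t).hasDerivWithinAt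

end RealIntegrals

/-! ### The covariance computation for curves in a Hilbert space. -/

lemma continuousOn_of_norm_sub_sq_le {H : Type*} [NormedAddCommGroup H] {f : ℝ → H} {F : ℝ → ℝ}
    {S : Set ℝ} (hF : ContinuousOn F S)
    (h : ∀ r ∈ S, ∀ q ∈ S, ‖f r - f q‖ ^ 2 ≤ |F r - F q|) : ContinuousOn f S := by
  intro q hq
  rw [ContinuousWithinAt, tendsto_iff_norm_sub_tendsto_zero]
  have h1 : Tendsto (fun r ↦ Real.sqrt |F r - F q|) (𝓝[S] q) (𝓝 0) := by
    have : Tendsto (fun r ↦ Real.sqrt |F r - F q|) (𝓝[S] q) (𝓝 (Real.sqrt |F q - F q|)) :=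
      (((hF q hq).sub tendsto_const_nhds).abs).sqrt
    simpa using this
  refine squeeze_zero' (Eventually.of_forall fun _ ↦ norm_nonneg _) ?_ h1
  filter_upwards [self_mem_nhdsWithin] with r hr
  exact Real.le_sqrt_of_sq_le (h r hr q hq)

/-- The covariance structure of a Brownian motion `b` and of a noisy signal `v` of its final value,
as curves in a Hilbert space; `g` is the remaining variance of the noise. -/
structure IsSignalPair {H : Type*} [NormedAddCommGroup H] [InnerProductSpace ℝ H] (T : ℝ)
    (g : ℝ → ℝ) (b v : ℝ → H) : Prop where
  pos : 0 < T
  continuousOn : ContinuousOn g (Set.Icc 0 T)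
  antitoneOn : AntitoneOn g (Set.Icc 0 T)
  final : g T = 0
  inner_b_b : ∀ s ∈ Set.Icc 0 T, ∀ t ∈ Set.Icc 0 T, s ≤ t → inner ℝ (b s) (b t) = s
  inner_b_v : ∀ s ∈ Set.Icc 0 T, ∀ t ∈ Set.Icc 0 T, inner ℝ (b s) (v t) = s
  inner_v_v : ∀ s ∈ Set.Icc 0 T, ∀ t ∈ Set.Icc 0 T, s ≤ t → inner ℝ (v s) (v t) = T + g t

section Hilbert

variable {H : Type*} [NormedAddCommGroup H] [InnerProductSpace ℝ H]

/-- The drift rate of `b` at time `r`, given the signal `v`. -/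
noncomputable def hilbertDrift (T : ℝ) (g : ℝ → ℝ) (b v : ℝ → H) (r : ℝ) : H :=
  (T + g r - r)⁻¹ • (v r - b r)

/-- The curve `b` with its drift removed. -/
noncomputable def innovation (T : ℝ) (g : ℝ → ℝ) (b v : ℝ → H) (t : ℝ) : H :=
  b t - ∫ r in (0 : ℝ)..t, hilbertDrift T g b v r

namespace IsSignalPair

variable {T : ℝ} {g : ℝ → ℝ} {b v : ℝ → H} (h : IsSignalPair T g b v)
include h

lemma nonneg {r : ℝ} (hr : r ∈ Set.Icc 0 T) : 0 ≤ g r := by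
  rw [← h.final]
  exact h.antitoneOn hr ⟨h.pos.le, le_rfl⟩ hr.2

lemma sub_le {r : ℝ} (hr : r ∈ Set.Icc 0 T) : T - r ≤ T + g r - r := by
  linarith [h.nonneg hr]

lemma var_pos {r : ℝ} (hr : r ∈ Set.Ico 0 T) : 0 < T + g r - r := by
  linarith [h.sub_le ⟨hr.1, hr.2.le⟩, hr.2]

lemma inner_y_y {r q : ℝ} (hr : r ∈ Set.Icc 0 T) (hq : q ∈ Set.Icc 0 T) (hrq : r ≤ q) :
    inner ℝ (v r - b r) (v q - b q) = T + g q - q := by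
  rw [inner_sub_left, inner_sub_right, inner_sub_right, h.inner_v_v r hr q hq hrq,
    h.inner_b_b r hr q hq hrq, h.inner_b_v r hr q hq, real_inner_comm, h.inner_b_v q hq r hr]
  ring

lemma inner_b_y {u r : ℝ} (hu : u ∈ Set.Icc 0 T) (hr : r ∈ Set.Icc 0 T) (hur : u ≤ r) :
    inner ℝ (b u) (v r - b r) = 0 := by
  rw [inner_sub_right, h.inner_b_v u hu r hr, h.inner_b_b u hu r hr hur, sub_self]

lemma inner_b_y' {u r : ℝ} (hu : u ∈ Set.Icc 0 T) (hr : r ∈ Set.Icc 0 T) (hur : r ≤ u) :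
    inner ℝ (b u) (v r - b r) = u - r := by
  rw [inner_sub_right, h.inner_b_v u hu r hr, real_inner_comm, h.inner_b_b r hr u hu hur]

lemma inner_v_y {u r : ℝ} (hu : u ∈ Set.Icc 0 T) (hr : r ∈ Set.Icc 0 T) (hur : u ≤ r) :
    inner ℝ (v u) (v r - b r) = T + g r - r := by
  rw [inner_sub_right, h.inner_v_v u hu r hr hur, real_inner_comm, h.inner_b_v r hr u hu]

lemma inner_v_y' {u r : ℝ} (hu : u ∈ Set.Icc 0 T) (hr : r ∈ Set.Icc 0 T) (hur : r ≤ u) :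
    inner ℝ (v u) (v r - b r) = T + g u - r := by
  rw [inner_sub_right, real_inner_comm, h.inner_v_v r hr u hu hur, real_inner_comm,
    h.inner_b_v r hr u hu]

lemma continuousOn_b : ContinuousOn b (Set.Icc 0 T) := by
  refine continuousOn_of_norm_sub_sq_le (F := id) continuousOn_id fun r hr q hq ↦ ?_
  rw [← real_inner_self_eq_norm_sq, inner_sub_left, inner_sub_right, inner_sub_right,
    h.inner_b_b r hr r hr le_rfl, h.inner_b_b q hq q hq le_rfl, id, id]
  rcases le_total r q with hrq | hrq
  · rw [real_inner_comm (b r), h.inner_b_b r hr q hq hrq, abs_sub_comm]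
    exact le_trans (by linarith) (le_abs_self _)
  · rw [real_inner_comm (b q), h.inner_b_b q hq r hr hrq]
    exact le_trans (by linarith) (le_abs_self _)

lemma continuousOn_var : ContinuousOn (fun r ↦ T + g r - r) (Set.Icc 0 T) :=
  (h.continuousOn.const_add T).sub continuousOn_id

/-- The inner product of two values of v - b is the variance at the later time, so the curve has
orthogonal increments when run backwards, and the squared norm of an increment is the drop in
variance. -/
lemma continuousOn_y : ContinuousOn (fun r ↦ v r - b r) (Set.Icc 0 T) := by
  refine continuousOn_of_norm_sub_sq_le h.continuousOn_var fun r hr q hq ↦ ?_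
  rw [← real_inner_self_eq_norm_sq, inner_sub_left, inner_sub_right, inner_sub_right (v q - b q),
    h.inner_y_y hr hr le_rfl, h.inner_y_y hq hq le_rfl]
  rcases le_total r q with hrq | hrq
  · rw [real_inner_comm (v r - b r), h.inner_y_y hr hq hrq]
    exact le_trans (by linarith) (le_abs_self _)
  · rw [real_inner_comm (v q - b q), h.inner_y_y hq hr hrq, abs_sub_comm]
    exact le_trans (by linarith) (le_abs_self _)

lemma continuousOn_inv_var : ContinuousOn (fun r ↦ (T + g r - r)⁻¹) (Set.Ico 0 T) :=
  (h.continuousOn_var.mono Set.Ico_subset_Icc_self).inv₀ fun _ hr ↦ (h.var_pos hr).ne'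

lemma norm_y {r : ℝ} (hr : r ∈ Set.Icc 0 T) : ‖v r - b r‖ = Real.sqrt (T + g r - r) := by
  rw [← h.inner_y_y hr hr le_rfl, real_inner_self_eq_norm_sq, Real.sqrt_sq (norm_nonneg _)]

lemma inv_mul_sqrt_le {r : ℝ} (hr : r ∈ Set.Ico 0 T) :
    (T + g r - r)⁻¹ * Real.sqrt (T + g r - r) ≤ (T - r) ^ (-(1 / 2) : ℝ) := by
  have h0 : 0 < T - r := sub_pos.2 hr.2
  have h1 := h.var_pos hr
  have h2 : (T + g r - r)⁻¹ * Real.sqrt (T + g r - r) = (Real.sqrt (T + g r - r))⁻¹ := by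
    have h3 : Real.sqrt (T + g r - r) ≠ 0 := (Real.sqrt_pos.2 h1).ne'
    have h4 := Real.mul_self_sqrt h1.le
    conv_lhs => enter [1]; rw [← h4]
    field_simp
  rw [h2, Real.rpow_neg h0.le, ← Real.sqrt_eq_rpow]
  exact inv_anti₀ (Real.sqrt_pos.2 h0) (Real.sqrt_le_sqrt (h.sub_le ⟨hr.1, hr.2.le⟩))

/-- Dividing by the variance turns the norm, a standard deviation, into its inverse. The noise only
increases the variance beyond T - r, so the bound holds for every `g` and is integrable at the final
time. -/
lemma norm_drift_le {r : ℝ} (hr : r ∈ Set.Ico 0 T) :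
    ‖hilbertDrift T g b v r‖ ≤ (T - r) ^ (-(1 / 2) : ℝ) := by
  rw [hilbertDrift, norm_smul, h.norm_y ⟨hr.1, hr.2.le⟩, Real.norm_eq_abs,
    abs_of_pos (inv_pos.2 (h.var_pos hr))]
  exact h.inv_mul_sqrt_le hr

omit h in
lemma _root_.Enlargement.intervalIntegrable_sub_rpow_neg_half (T : ℝ) :
    IntervalIntegrable (fun r ↦ (T - r) ^ (-(1 / 2) : ℝ)) volume 0 T := by
  have := (intervalIntegral.intervalIntegrable_rpow' (a := T) (b := 0) (r := -(1 / 2))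
    (by norm_num)).comp_sub_left T
  simpa using this

lemma intervalIntegrable_drift_final :
    IntervalIntegrable (hilbertDrift T g b v) volume 0 T := by
  refine (intervalIntegrable_sub_rpow_neg_half T).mono_fun ?_ ?_
  -- The endpoint T is dropped: the variance vanishes there and its inverse is only the default
  -- value.
  · rw [Set.uIoc_of_le h.pos.le, ← restrict_Ioo_eq_restrict_Ioc]
    exact ((h.continuousOn_inv_var.smul (h.continuousOn_y.mono Set.Ico_subset_Icc_self)).mono
      Set.Ioo_subset_Ico_self).aestronglyMeasurable measurableSet_Ioo
  · rw [Set.uIoc_of_le h.pos.le, ← restrict_Ioo_eq_restrict_Ioc]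
    filter_upwards [ae_restrict_mem measurableSet_Ioo] with r hr
    refine (h.norm_drift_le ⟨hr.1.le, hr.2⟩).trans (le_abs_self _)

lemma intervalIntegrable_drift {s t : ℝ} (hs : s ∈ Set.Icc 0 T) (ht : t ∈ Set.Icc 0 T) :
    IntervalIntegrable (hilbertDrift T g b v) volume s t := by
  refine h.intervalIntegrable_drift_final.mono_set ?_
  rw [Set.uIcc_of_le h.pos.le]
  exact Set.uIcc_subset_Icc hs ht

lemma intervalIntegrable_inner_drift (z : H) {s t : ℝ} (hs : s ∈ Set.Icc 0 T)
    (ht : t ∈ Set.Icc 0 T) :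
    IntervalIntegrable (fun r ↦ inner ℝ z (hilbertDrift T g b v r)) volume s t := by
  have := h.intervalIntegrable_drift hs ht
  exact ⟨(innerSL ℝ z).integrable_comp this.1, (innerSL ℝ z).integrable_comp this.2⟩

variable [CompleteSpace H]

lemma inner_integral_drift (z : H) {s t : ℝ} (hs : s ∈ Set.Icc 0 T) (ht : t ∈ Set.Icc 0 T) :
    inner ℝ z (∫ r in s..t, hilbertDrift T g b v r) =
      ∫ r in s..t, inner ℝ z (hilbertDrift T g b v r) :=
  ((innerSL ℝ z).intervalIntegral_comp_comm (h.intervalIntegrable_drift hs ht)).symm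

omit [CompleteSpace H] in
lemma innovation_sub {s t : ℝ} (hs : s ∈ Set.Icc 0 T) (ht : t ∈ Set.Icc 0 T) :
    innovation T g b v t - innovation T g b v s =
      b t - b s - ∫ r in s..t, hilbertDrift T g b v r := by
  have h0 : (0 : ℝ) ∈ Set.Icc 0 T := ⟨le_rfl, h.pos.le⟩
  rw [innovation, innovation, ← intervalIntegral.integral_interval_sub_left
    (h.intervalIntegrable_drift h0 ht) (h.intervalIntegrable_drift h0 hs)]
  abel

/-- The increments of the innovation are orthogonal to the past of `b`. -/
lemma inner_b_innovation_sub {u s t : ℝ} (hu : u ∈ Set.Icc 0 T) (ht : t ∈ Set.Icc 0 T)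
    (hus : u ≤ s) (hst : s ≤ t) :
    inner ℝ (b u) (innovation T g b v t - innovation T g b v s) = 0 := by
  have hs : s ∈ Set.Icc 0 T := ⟨hu.1.trans hus, hst.trans ht.2⟩
  rw [h.innovation_sub hs ht, inner_sub_right, inner_sub_right, h.inner_integral_drift _ hs ht,
    h.inner_b_b u hu t ht (hus.trans hst), h.inner_b_b u hu s hs hus,
    intervalIntegral_congr_Ioo (h := fun _ ↦ 0) hst]
  · simp
  · intro r hr
    rw [hilbertDrift, inner_smul_right, h.inner_b_y hu ⟨hs.1.trans hr.1.le, hr.2.le.trans ht.2⟩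
      (hus.trans hr.1.le), mul_zero]

/-- The increments of the innovation are orthogonal to the past of `v`. -/
lemma inner_v_innovation_sub {u s t : ℝ} (hu : u ∈ Set.Icc 0 T) (ht : t ∈ Set.Icc 0 T)
    (hus : u ≤ s) (hst : s ≤ t) :
    inner ℝ (v u) (innovation T g b v t - innovation T g b v s) = 0 := by
  have hs : s ∈ Set.Icc 0 T := ⟨hu.1.trans hus, hst.trans ht.2⟩
  rw [h.innovation_sub hs ht, inner_sub_right, inner_sub_right, h.inner_integral_drift _ hs ht,
    real_inner_comm, h.inner_b_v t ht u hu, real_inner_comm, h.inner_b_v s hs u hu,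
    intervalIntegral_congr_Ioo (h := fun _ ↦ 1) hst]
  · simp
  · intro r hr
    have hr' : r ∈ Set.Ico 0 T := ⟨hs.1.trans hr.1.le, hr.2.trans_le ht.2⟩
    rw [hilbertDrift, inner_smul_right, h.inner_v_y hu ⟨hr'.1, hr'.2.le⟩ (hus.trans hr.1.le),
      inv_mul_cancel₀ (h.var_pos hr').ne']

/-- The increments of the innovation are orthogonal to its past. -/
lemma inner_innovation_innovation_sub {u s t : ℝ} (hu : u ∈ Set.Icc 0 T) (ht : t ∈ Set.Icc 0 T)
    (hus : u ≤ s) (hst : s ≤ t) :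
    inner ℝ (innovation T g b v u) (innovation T g b v t - innovation T g b v s) = 0 := by
  have h0 : (0 : ℝ) ∈ Set.Icc 0 T := ⟨le_rfl, h.pos.le⟩
  conv_lhs => enter [2]; rw [innovation]
  rw [inner_sub_left, h.inner_b_innovation_sub hu ht hus hst, real_inner_comm,
    h.inner_integral_drift _ h0 hu, intervalIntegral_congr_Ioo (h := fun _ ↦ 0) hu.1]
  · simp
  · intro r hr
    have hr' : r ∈ Set.Icc 0 T := ⟨hr.1.le, hr.2.le.trans hu.2⟩
    rw [hilbertDrift, inner_smul_right, real_inner_comm, inner_sub_left,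
      h.inner_b_innovation_sub hr' ht (hr.2.le.trans hus) hst,
      h.inner_v_innovation_sub hr' ht (hr.2.le.trans hus) hst]
    simp

omit [CompleteSpace H] in
lemma continuousOn_innovation : ContinuousOn (innovation T g b v) (Set.Icc 0 T) := by
  refine h.continuousOn_b.sub ?_
  have := intervalIntegral.continuousOn_primitive_interval (a := 0) (b := T) (μ := volume)
    (f := hilbertDrift T g b v)
    (by rw [Set.uIcc_of_le h.pos.le, integrableOn_Icc_iff_integrableOn_Ioc,
          ← intervalIntegrable_iff_integrableOn_Ioc_of_le h.pos.le]
        exact h.intervalIntegrable_drift_final)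
  rwa [Set.uIcc_of_le h.pos.le] at this

/-- Let D be the integral over [s, t] of (t - r) / (T + g(r) - r). The increment of the innovation
has inner product t - s - D with that of `b`, and -D with the integrated drift; the difference is t
- s. Since t < T, the inverse variance is continuous on [s, t]. -/
lemma inner_innovation_sub_self_of_lt {s t : ℝ} (hs : s ∈ Set.Icc 0 T) (hst : s ≤ t)
    (htT : t < T) :
    inner ℝ (innovation T g b v t - innovation T g b v s)
      (innovation T g b v t - innovation T g b v s) = t - s := by
  have ht : t ∈ Set.Icc 0 T := ⟨hs.1.trans hst, htT.le⟩
  have hinv : ContinuousOn (fun r ↦ (T + g r - r)⁻¹) (Set.Icc s t) :=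
    h.continuousOn_inv_var.mono fun r hr ↦ ⟨hs.1.trans hr.1, hr.2.trans_lt htT⟩
  have hb : inner ℝ (innovation T g b v t - innovation T g b v s) (b t - b s) =
      (t - s) - ∫ r in s..t, (t - r) * (T + g r - r)⁻¹ := by
    rw [h.innovation_sub hs ht, real_inner_comm, inner_sub_right, h.inner_integral_drift _ hs ht]
    congr 1
    · rw [inner_sub_left, inner_sub_right, inner_sub_right, h.inner_b_b t ht t ht le_rfl,
        h.inner_b_b s hs s hs le_rfl, real_inner_comm (b s) (b t), h.inner_b_b s hs t ht hst]
      ring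
    · refine intervalIntegral_congr_Ioo hst fun r hr ↦ ?_
      have hr' : r ∈ Set.Icc 0 T := ⟨hs.1.trans hr.1.le, hr.2.le.trans ht.2⟩
      rw [hilbertDrift, inner_smul_right, inner_sub_left, h.inner_b_y' ht hr' hr.2.le,
        h.inner_b_y hs hr' hr.1.le]
      ring
  have hU : inner ℝ (innovation T g b v t - innovation T g b v s)
      (∫ r in s..t, hilbertDrift T g b v r) = -∫ r in s..t, (t - r) * (T + g r - r)⁻¹ := by
    rw [h.inner_integral_drift _ hs ht, ← integral_integral_eq_integral_sub_mul hst hinv,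
      ← intervalIntegral.integral_neg]
    refine intervalIntegral_congr_Ioo hst fun r hr ↦ ?_
    have hr' : r ∈ Set.Icc 0 T := ⟨hs.1.trans hr.1.le, hr.2.le.trans ht.2⟩
    have hr'' : r ∈ Set.Ico 0 T := ⟨hr'.1, hr.2.trans htT⟩
    -- The increment is cut at r: the part after r is orthogonal to v_r - b_r, and only the part
    -- before r contributes.
    have hsplit : innovation T g b v t - innovation T g b v s =
        (innovation T g b v t - innovation T g b v r) +
          (innovation T g b v r - innovation T g b v s) := by abel
    rw [hilbertDrift, inner_smul_right, hsplit, inner_add_left]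
    have h1 : inner ℝ (innovation T g b v t - innovation T g b v r) (v r - b r) = 0 := by
      rw [real_inner_comm, inner_sub_left, h.inner_b_innovation_sub hr' ht le_rfl hr.2.le,
        h.inner_v_innovation_sub hr' ht le_rfl hr.2.le, sub_self]
    have h2 : inner ℝ (innovation T g b v r - innovation T g b v s) (v r - b r) =
        -((T + g r - r) * ∫ q in s..r, (T + g q - q)⁻¹) := by
      rw [h.innovation_sub hs hr', real_inner_comm, inner_sub_right, inner_sub_right,
        h.inner_integral_drift _ hs hr', real_inner_comm (b r), h.inner_b_y hr' hr' le_rfl,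
        real_inner_comm (b s), h.inner_b_y hs hr' hr.1.le, ← intervalIntegral.integral_const_mul,
        sub_self, zero_sub]
      congr 1
      refine intervalIntegral_congr_Ioo hr.1.le fun q hq ↦ ?_
      have hq' : q ∈ Set.Icc 0 T := ⟨hs.1.trans hq.1.le, hq.2.le.trans hr'.2⟩
      rw [hilbertDrift, inner_smul_right, real_inner_comm, h.inner_y_y hq' hr' hq.2.le, mul_comm]
    rw [h1, h2, zero_add]
    have := (h.var_pos hr'').ne'
    field_simp
  conv_lhs => enter [3]; rw [h.innovation_sub hs ht]
  rw [inner_sub_right, hb, hU]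
  ring

/-- The variance of the increments of the innovation is that of Brownian motion. -/
lemma inner_innovation_sub_self {s t : ℝ} (hs : s ∈ Set.Icc 0 T) (ht : t ∈ Set.Icc 0 T)
    (hst : s ≤ t) :
    inner ℝ (innovation T g b v t - innovation T g b v s)
      (innovation T g b v t - innovation T g b v s) = t - s := by
  rcases ht.2.lt_or_eq with htT | rfl
  · exact h.inner_innovation_sub_self_of_lt hs hst htT
  -- At the final time the identity follows by letting r increase to it, since the innovation is a
  -- continuous curve.
  rcases hst.lt_or_eq with hst | rfl
  · have hmem : ∀ᶠ r in 𝓝[<] t, r ∈ Set.Ico s t :=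
      Filter.mem_of_superset (Ioo_mem_nhdsLT hst) Set.Ioo_subset_Ico_self
    have hle : 𝓝[<] t ≤ 𝓝[Set.Icc 0 t] t := by
      rw [← nhdsWithin_Ioo_eq_nhdsLT h.pos]
      exact nhdsWithin_mono _ Set.Ioo_subset_Icc_self
    have h1 : Tendsto (fun r ↦ innovation t g b v r - innovation t g b v s) (𝓝[<] t)
        (𝓝 (innovation t g b v t - innovation t g b v s)) :=
      (((h.continuousOn_innovation t ht).mono_left hle)).sub tendsto_const_nhds
    refine tendsto_nhds_unique (h1.inner h1) ?_
    refine Tendsto.congr' (f₁ := fun r ↦ r - s) ?_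
      ((tendsto_id.mono_left nhdsWithin_le_nhds).sub_const s)
    filter_upwards [hmem] with r hr
    exact (h.inner_innovation_sub_self_of_lt hs hr.1 hr.2).symm
  · simp

/-- The innovation is correlated with the signal. -/
lemma inner_innovation_v {s t : ℝ} (hs : s ∈ Set.Icc 0 T) (ht : t ∈ Set.Icc 0 T) (hst : s ≤ t) :
    inner ℝ (v s) (innovation T g b v t) = ∫ r in (0 : ℝ)..s, (g r - g s) * (T + g r - r)⁻¹ := by
  have h0 : (0 : ℝ) ∈ Set.Icc 0 T := ⟨le_rfl, h.pos.le⟩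
  have hsplit : innovation T g b v t =
      innovation T g b v s + (innovation T g b v t - innovation T g b v s) := by abel
  rw [hsplit, inner_add_right, h.inner_v_innovation_sub hs ht le_rfl hst, add_zero, innovation,
    inner_sub_right, h.inner_integral_drift _ h0 hs, real_inner_comm, h.inner_b_v s hs s hs]
  -- The inner product of v_s with b_s is written as an integral, to be merged with the drift term:
  -- 1 - (T + g(s) - r) / (T + g(r) - r).
  have h1 : (s : ℝ) = ∫ _ in (0 : ℝ)..s, (1 : ℝ) := by simp
  conv_lhs => enter [1]; rw [h1]
  rw [← intervalIntegral.integral_sub (by simp) (h.intervalIntegrable_inner_drift _ h0 hs)]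
  refine intervalIntegral_congr_Ioo hs.1 fun r hr ↦ ?_
  have hr' : r ∈ Set.Ico 0 T := ⟨hr.1.le, hr.2.trans_le hs.2⟩
  have := (h.var_pos hr').ne'
  rw [hilbertDrift, inner_smul_right, h.inner_v_y' hs ⟨hr'.1, hr'.2.le⟩ hr.2.le]
  field_simp
  ring

/-- The integrand in `inner_innovation_v` is nonnegative because `g` is antitone, and strictly
positive on some (0, c) because `g` is continuous at 0 and exceeds g(s) there. -/
lemma inner_innovation_v_pos {s t : ℝ} (hs : s ∈ Set.Icc 0 T) (ht : t ∈ Set.Icc 0 T)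
    (hst : s ≤ t) (hg : g s < g 0) : 0 < inner ℝ (v s) (innovation T g b v t) := by
  have h0 : (0 : ℝ) ∈ Set.Icc 0 T := ⟨le_rfl, h.pos.le⟩
  have hs0 : 0 < s := by
    rcases hs.1.lt_or_eq with h' | h'
    · exact h'
    · rw [← h'] at hg; exact absurd hg (lt_irrefl _)
  obtain ⟨c, hc, hgc⟩ : ∃ c ∈ Set.Ioo 0 s, g s < g c := by
    have hle : 𝓝[>] (0 : ℝ) ≤ 𝓝[Set.Icc 0 T] 0 := by
      rw [← nhdsWithin_Ioo_eq_nhdsGT h.pos]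
      exact nhdsWithin_mono _ Set.Ioo_subset_Icc_self
    have h1 : ∀ᶠ r in 𝓝[>] (0 : ℝ), g s < g r :=
      ((h.continuousOn 0 h0).mono_left hle).eventually (lt_mem_nhds hg)
    obtain ⟨c, hc1, hc2⟩ := (h1.and (Ioo_mem_nhdsGT hs0)).exists
    exact ⟨c, hc2, hc1⟩
  have hcT : c ∈ Set.Icc 0 T := ⟨hc.1.le, hc.2.le.trans hs.2⟩
  -- The variance may vanish at s = T, so integrability comes from that of the drift rather than
  -- from continuity.
  have hint : IntervalIntegrable (fun r ↦ (g r - g s) * (T + g r - r)⁻¹) volume 0 s := by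
    have h1 : IntervalIntegrable
        (fun r ↦ 1 - inner ℝ (v s) (hilbertDrift T g b v r)) volume 0 s :=
      (by simp : IntervalIntegrable (fun _ ↦ (1 : ℝ)) volume 0 s).sub
        (h.intervalIntegrable_inner_drift _ h0 hs)
    rw [intervalIntegrable_iff_integrableOn_Ioo_of_le hs.1] at h1 ⊢
    refine h1.congr_fun (fun r hr ↦ ?_) measurableSet_Ioo
    have hr' : r ∈ Set.Ico 0 T := ⟨hr.1.le, hr.2.trans_le hs.2⟩
    have := (h.var_pos hr').ne'
    simp only
    rw [hilbertDrift, inner_smul_right, h.inner_v_y' hs ⟨hr'.1, hr'.2.le⟩ hr.2.le]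
    field_simp
    ring
  have hint1 : IntervalIntegrable (fun r ↦ (g r - g s) * (T + g r - r)⁻¹) volume 0 c :=
    hint.mono_set (by
      rw [Set.uIcc_of_le hc.1.le, Set.uIcc_of_le hs.1]; exact Set.Icc_subset_Icc_right hc.2.le)
  have hint2 : IntervalIntegrable (fun r ↦ (g r - g s) * (T + g r - r)⁻¹) volume c s :=
    hint.mono_set (by
      rw [Set.uIcc_of_le hc.2.le, Set.uIcc_of_le hs.1]; exact Set.Icc_subset_Icc_left hc.1.le)
  rw [h.inner_innovation_v hs ht hst, ← intervalIntegral.integral_add_adjacent_intervals hint1 hint2]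
  refine add_pos_of_pos_of_nonneg
    (intervalIntegral.intervalIntegral_pos_of_pos_on hint1 (fun r hr ↦ ?_) hc.1) ?_
  · have hr' : r ∈ Set.Ico 0 T := ⟨hr.1.le, hr.2.trans_le hcT.2⟩
    have h1 : g c ≤ g r := h.antitoneOn ⟨hr'.1, hr'.2.le⟩ hcT hr.2.le
    exact mul_pos (by linarith) (inv_pos.2 (h.var_pos hr'))
  · refine intervalIntegral.integral_nonneg hc.2.le fun r hr ↦ ?_
    have hr' : r ∈ Set.Icc 0 T := ⟨hcT.1.trans hr.1, hr.2.trans hs.2⟩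
    have h1 : g s ≤ g r := h.antitoneOn hr' hs hr.2
    exact mul_nonneg (by linarith) (inv_nonneg.2 (by linarith [h.sub_le hr', hr'.2]))

/-- Without noise, the innovation is orthogonal to the final value of `b`. -/
lemma inner_final_innovation (hg : g 0 = 0) {t : ℝ} (ht : t ∈ Set.Icc 0 T) :
    inner ℝ (b T) (innovation T g b v t) = 0 := by
  have h0 : (0 : ℝ) ∈ Set.Icc 0 T := ⟨le_rfl, h.pos.le⟩
  have hT : T ∈ Set.Icc 0 T := ⟨h.pos.le, le_rfl⟩
  have hvT : inner ℝ (v 0) (innovation T g b v t) = 0 := by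
    have h1 : innovation T g b v t = innovation T g b v 0 +
      (innovation T g b v t - innovation T g b v 0) := by abel
    rw [h1, inner_add_right, h.inner_v_innovation_sub h0 ht le_rfl ht.1, innovation,
      intervalIntegral.integral_same, sub_zero, real_inner_comm, h.inner_b_v 0 h0 0 h0, add_zero]
  -- The squared distance between the two vectors is g(0).
  have hv : v 0 = b T := by
    rw [← sub_eq_zero, ← inner_self_eq_zero (𝕜 := ℝ), inner_sub_left, inner_sub_right,
      inner_sub_right, h.inner_v_v 0 h0 0 h0 le_rfl, h.inner_b_v T hT 0 h0, real_inner_comm,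
      h.inner_b_v T hT 0 h0, h.inner_b_b T hT T hT le_rfl, hg]
    ring
  rw [← hv, hvT]

end IsSignalPair

end Hilbert

/-! ### Brownian motions as vectors in L². -/

section Brownian

variable {Ω : Type*} [mΩ : MeasurableSpace Ω] {T : ℝ} {P : Measure Ω} {X : Time T → Ω → ℝ}

namespace IsBrownianMotion

variable (hX : IsBrownianMotion X P)
include hX

lemma ae_zero (hT : 0 ≤ T) : ∀ᵐ ω ∂P, X ⟨0, le_rfl, hT⟩ ω = 0 := hX.zero _ rfl

lemma hasLaw (t : Time T) : HasLaw (X t) (gaussianReal 0 (t : ℝ).toNNReal) P := by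
  have hT : 0 ≤ T := t.2.1.trans t.2.2
  have h := hX.hasLaw_sub ⟨0, le_rfl, hT⟩ t t.2.1
  rw [sub_zero] at h
  refine h.congr ?_
  filter_upwards [hX.ae_zero hT] with ω hω
  simp [hω]

lemma memLp (t : Time T) : MemLp (X t) 2 P := (hX.hasLaw t).hasGaussianLaw.memLp_two

lemma integral_eq_zero (t : Time T) : ∫ ω, X t ω ∂P = 0 := by
  rw [(hX.hasLaw t).integral_eq, integral_id_gaussianReal]

lemma isGaussianProcess (hT : 0 ≤ T) : IsGaussianProcess X P := by
  have : Fact (0 ≤ T) := ⟨hT⟩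
  exact hX.hasIndepIncrements.isGaussianProcess (fun t ↦ (hX.hasLaw t).hasGaussianLaw)
    (hX.ae_zero hT)

/-- The Brownian motion at time `t`, as an element of `L²(P)`. -/
noncomputable def vec (t : Time T) : Lp ℝ 2 P := (hX.memLp t).toLp

lemma coeFn_vec (t : Time T) : hX.vec t =ᵐ[P] X t := (hX.memLp t).coeFn_toLp

lemma inner_vec (s t : Time T) : inner ℝ (hX.vec s) (hX.vec t) = min (s : ℝ) t := by
  wlog hst : s ≤ t generalizing s t
  · rw [real_inner_comm, this t s (le_of_not_ge hst), min_comm]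
  have hT : 0 ≤ T := t.2.1.trans t.2.2
  have hind : IndepFun (X s) (X t - X s) P :=
    hX.hasIndepIncrements.indepFun_eval_sub (r := ⟨0, le_rfl, hT⟩) s.2.1 hst (hX.ae_zero hT)
  have hmul := hind.integral_mul_eq_mul_integral (hX.memLp s).1
    ((hX.memLp t).sub (hX.memLp s)).1
  have hsq : ∫ ω, X s ω * X s ω ∂P = s := by
    have h1 := (hX.hasLaw s).variance_eq
    rw [variance_id_gaussianReal, variance_of_integral_eq_zero (hX.measurable s).aemeasurable
      (hX.integral_eq_zero s), Real.coe_toNNReal _ s.2.1] at h1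
    simpa [pow_two] using h1
  rw [hX.integral_eq_zero s, zero_mul] at hmul
  rw [inner_eq_integral (hX.coeFn_vec s) (hX.coeFn_vec t), min_eq_left (by exact hst), ← hsq,
    ← add_zero (∫ ω, X s ω * X s ω ∂P), ← hmul, ← integral_add]
  · congr 1
    ext ω
    simp only [Pi.mul_apply, Pi.sub_apply]
    ring
  · exact (hX.memLp s).integrable_mul (hX.memLp s)
  · exact (hX.memLp s).integrable_mul ((hX.memLp t).sub (hX.memLp s))

end IsBrownianMotion

lemma inner_vec_eq_zero_of_indepFun {B W : Time T → Ω → ℝ} (hB : IsBrownianMotion B P)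
    (hW : IsBrownianMotion W P) (hBW : IndepFun (fun ω t ↦ B t ω) (fun ω t ↦ W t ω) P)
    (s t : Time T) : inner ℝ (hB.vec s) (hW.vec t) = 0 := by
  have hind : IndepFun (B s) (W t) P :=
    hBW.comp (measurable_pi_apply s) (measurable_pi_apply t)
  rw [inner_eq_integral (hB.coeFn_vec s) (hW.coeFn_vec t),
    hind.integral_fun_mul_eq_mul_integral (hB.memLp s).1 (hW.memLp t).1, hB.integral_eq_zero,
    zero_mul]

/-- The Gaussian space generated by two Brownian motions. -/
noncomputable def gaussianSpace {B W : Time T → Ω → ℝ} (hB : IsBrownianMotion B P)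
    (hW : IsBrownianMotion W P) : Submodule ℝ (Lp ℝ 2 P) :=
  (Submodule.span ℝ (Set.range (Sum.elim hB.vec hW.vec))).topologicalClosure

lemma isGaussianSpace_gaussianSpace [IsProbabilityMeasure P] (hT : 0 ≤ T) {B W : Time T → Ω → ℝ}
    (hB : IsBrownianMotion B P) (hW : IsBrownianMotion W P)
    (hBW : IndepFun (fun ω t ↦ B t ω) (fun ω t ↦ W t ω) P) :
    IsGaussianSpace (gaussianSpace hB hW) := by
  refine IsGaussianSpace.topologicalClosure (IsGaussianProcess.isGaussianSpace_span
    (IsGaussianProcess.sumElim (hB.isGaussianProcess hT) (hW.isGaussianProcess hT) hBW) ?_ ?_)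
  · rintro (s | s)
    · exact hB.integral_eq_zero s
    · exact hW.integral_eq_zero s
  · rintro (s | s)
    · exact hB.coeFn_vec s
    · exact hW.coeFn_vec s

lemma vec_left_mem_gaussianSpace {B W : Time T → Ω → ℝ} (hB : IsBrownianMotion B P)
    (hW : IsBrownianMotion W P) (t : Time T) : hB.vec t ∈ gaussianSpace hB hW :=
  Submodule.le_topologicalClosure _ (Submodule.subset_span ⟨.inl t, rfl⟩)

end Brownian

/-! ### The Wiener isometry. -/

section Wiener

variable {Ω : Type*} [mΩ : MeasurableSpace Ω] {T : ℝ} {P : Measure Ω} {W : Time T → Ω → ℝ}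

/-- The right-hand side is the covariance of two Brownian increments, expanded by bilinearity; this
is the isometry for a pair of intervals. -/
lemma volume_real_Ioc_inter_Ioc {a b c d : ℝ} (hab : a ≤ b) (hcd : c ≤ d) :
    volume.real (Set.Ioc a b ∩ Set.Ioc c d) = min b d - min b c - min a d + min a c := by
  rw [Set.Ioc_inter_Ioc, Real.volume_real_Ioc]
  rcases le_total b d with h1 | h1 <;> rcases le_total b c with h2 | h2 <;>
    rcases le_total a d with h3 | h3 <;> rcases le_total a c with h4 | h4 <;>
    simp only [min_def, max_def] <;> split_ifs <;> linarith

namespace StepFunction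

lemma memLp_eval (φ : StepFunction T) :
    MemLp φ.eval 2 (volume.restrict (Set.Icc 0 T)) := by
  unfold eval
  refine memLp_finsetSum _ fun i _ ↦ MemLp.const_mul ?_ _
  exact (memLp_const (1 : ℝ)).indicator measurableSet_Ioc

lemma integral_eval_mul_eval (φ ψ : StepFunction T) :
    ∫ s in Set.Icc 0 T, φ.eval s * ψ.eval s = ∑ i, ∑ j, φ.coeff i * ψ.coeff j *
      (min (φ.right i : ℝ) (ψ.right j) - min (φ.right i : ℝ) (ψ.left j)
        - min (φ.left i : ℝ) (ψ.right j) + min (φ.left i : ℝ) (ψ.left j)) := by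
  have hprod : ∀ s, φ.eval s * ψ.eval s = ∑ i, ∑ j, φ.coeff i * ψ.coeff j *
      (Set.Ioc (φ.left i : ℝ) (φ.right i) ∩ Set.Ioc (ψ.left j : ℝ) (ψ.right j)).indicator 1 s := by
    intro s
    rw [eval, eval, Finset.sum_mul_sum]
    refine Finset.sum_congr rfl fun i _ ↦ Finset.sum_congr rfl fun j _ ↦ ?_
    rw [Set.inter_indicator_one, Pi.mul_apply]
    ring
  have hint : ∀ i j, Integrable (fun s ↦ φ.coeff i * ψ.coeff j *
      (Set.Ioc (φ.left i : ℝ) (φ.right i) ∩ Set.Ioc (ψ.left j : ℝ) (ψ.right j)).indicator 1 s)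
      (volume.restrict (Set.Icc 0 T)) := fun i j ↦
    ((integrable_const (1 : ℝ)).indicator (measurableSet_Ioc.inter measurableSet_Ioc)).const_mul _
  simp_rw [hprod]
  rw [integral_finsetSum _ fun i _ ↦ integrable_finsetSum _ fun j _ ↦ hint i j]
  refine Finset.sum_congr rfl fun i _ ↦ ?_
  rw [integral_finsetSum _ fun j _ ↦ hint i j]
  refine Finset.sum_congr rfl fun j _ ↦ ?_
  rw [integral_const_mul, integral_indicator_one (measurableSet_Ioc.inter measurableSet_Ioc),
    ← volume_real_Ioc_inter_Ioc (φ.left_le_right i) (ψ.left_le_right j), measureReal_def,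
    measureReal_def, Measure.restrict_apply (measurableSet_Ioc.inter measurableSet_Ioc),
    Set.inter_eq_left.2]
  intro s hs
  exact ⟨(φ.left i).2.1.trans hs.1.1.le, hs.1.2.trans (φ.right i).2.2⟩

/-- The elementary integral, as an element of `L²(P)`. -/
noncomputable def vec (φ : StepFunction T) (hW : IsBrownianMotion W P) : Lp ℝ 2 P :=
  ∑ i, φ.coeff i • (hW.vec (φ.right i) - hW.vec (φ.left i))

lemma coeFn_vec (φ : StepFunction T) (hW : IsBrownianMotion W P) :
    φ.vec hW =ᵐ[P] φ.integral W := by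
  have h1 : ∀ᵐ ω ∂P, ∀ i, (φ.coeff i • (hW.vec (φ.right i) - hW.vec (φ.left i)) : Lp ℝ 2 P) ω =
      φ.coeff i * (W (φ.right i) ω - W (φ.left i) ω) := ae_all_iff.2 fun i ↦ by
    filter_upwards [Lp.coeFn_smul (φ.coeff i) (hW.vec (φ.right i) - hW.vec (φ.left i)),
      Lp.coeFn_sub (hW.vec (φ.right i)) (hW.vec (φ.left i)), hW.coeFn_vec (φ.right i),
      hW.coeFn_vec (φ.left i)] with ω h1 h2 h3 h4
    rw [h1, Pi.smul_apply, h2, Pi.sub_apply, h3, h4, smul_eq_mul]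
  filter_upwards [h1, Lp.coeFn_finsetSum Finset.univ
    (fun i ↦ φ.coeff i • (hW.vec (φ.right i) - hW.vec (φ.left i)))] with ω h1 h2
  rw [vec, h2, Finset.sum_apply, integral]
  exact Finset.sum_congr rfl fun i _ ↦ h1 i

lemma inner_vec_vec (φ ψ : StepFunction T) (hW : IsBrownianMotion W P) :
    inner ℝ (φ.vec hW) (ψ.vec hW) = ∫ s in Set.Icc 0 T, φ.eval s * ψ.eval s := by
  rw [integral_eval_mul_eval, vec, vec, sum_inner]
  refine Finset.sum_congr rfl fun i _ ↦ ?_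
  rw [inner_sum]
  refine Finset.sum_congr rfl fun j _ ↦ ?_
  simp only [real_inner_smul_left, real_inner_smul_right, inner_sub_left, inner_sub_right,
    hW.inner_vec]
  ring

end StepFunction

namespace IsWienerIntegral

variable {f f' : ℝ → ℝ} {X X' : Ω → ℝ}

/-- One sequence of step functions converges on both sides of the isometry, so inner products pass
to the limit. -/
lemma exists_tendsto (hW : IsBrownianMotion W P) (hX : IsWienerIntegral W P f X)
    (hf : MemLp f 2 (volume.restrict (Set.Icc 0 T))) :
    ∃ φ : ℕ → StepFunction T, Tendsto (fun n ↦ (φ n).memLp_eval.toLp) atTop (𝓝 hf.toLp) ∧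
      Tendsto (fun n ↦ (φ n).vec hW) atTop (𝓝 hX.1.toLp) := by
  obtain ⟨φ, h1, h2⟩ := hX.2
  refine ⟨φ, ?_, ?_⟩
  · rw [Lp.tendsto_Lp_iff_tendsto_eLpNorm'' (fun n ↦ (φ n).eval)]
    refine h1.congr fun n ↦ ?_
    rw [← eLpNorm_neg]
    congr 1
    ext s
    simp
  · rw [Lp.tendsto_Lp_iff_tendsto_eLpNorm']
    refine h2.congr fun n ↦ ?_
    rw [← eLpNorm_neg]
    refine eLpNorm_congr_ae ?_
    filter_upwards [(φ n).coeFn_vec hW, hX.1.coeFn_toLp] with ω h3 h4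
    simp [h3, h4]

/-- The Wiener isometry. -/
lemma inner_toLp (hW : IsBrownianMotion W P) (hX : IsWienerIntegral W P f X)
    (hX' : IsWienerIntegral W P f' X') (hf : MemLp f 2 (volume.restrict (Set.Icc 0 T)))
    (hf' : MemLp f' 2 (volume.restrict (Set.Icc 0 T))) :
    inner ℝ hX.1.toLp hX'.1.toLp = ∫ s in Set.Icc 0 T, f s * f' s := by
  obtain ⟨φ, h1, h2⟩ := hX.exists_tendsto hW hf
  obtain ⟨ψ, h3, h4⟩ := hX'.exists_tendsto hW hf'
  rw [← inner_eq_integral hf.coeFn_toLp hf'.coeFn_toLp]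
  refine tendsto_nhds_unique (h2.inner h4) ((h1.inner h3).congr fun n ↦ ?_)
  rw [StepFunction.inner_vec_vec,
    inner_eq_integral (φ n).memLp_eval.coeFn_toLp (ψ n).memLp_eval.coeFn_toLp]

lemma inner_vec_toLp {B : Time T → Ω → ℝ} (hB : IsBrownianMotion B P) (hW : IsBrownianMotion W P)
    (hBW : IndepFun (fun ω t ↦ B t ω) (fun ω t ↦ W t ω) P) (hX : IsWienerIntegral W P f X)
    (hf : MemLp f 2 (volume.restrict (Set.Icc 0 T))) (t : Time T) :
    inner ℝ (hB.vec t) hX.1.toLp = 0 := by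
  obtain ⟨φ, -, h2⟩ := hX.exists_tendsto hW hf
  refine tendsto_nhds_unique ((tendsto_const_nhds (x := hB.vec t)).inner h2)
    (tendsto_const_nhds.congr fun n ↦ ?_)
  simp [StepFunction.vec, inner_sum, real_inner_smul_right, inner_sub_right,
    inner_vec_eq_zero_of_indepFun hB hW hBW]

lemma toLp_mem_gaussianSpace {B : Time T → Ω → ℝ} (hB : IsBrownianMotion B P)
    (hW : IsBrownianMotion W P) (hX : IsWienerIntegral W P f X)
    (hf : MemLp f 2 (volume.restrict (Set.Icc 0 T))) :
    hX.1.toLp ∈ gaussianSpace hB hW := by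
  obtain ⟨φ, -, h2⟩ := hX.exists_tendsto hW hf
  refine mem_closure_of_tendsto h2 (Eventually.of_forall fun n ↦ ?_)
  refine Submodule.sum_mem _ fun i _ ↦ Submodule.smul_mem _ _ (Submodule.sub_mem _ ?_ ?_)
  · exact Submodule.subset_span ⟨.inr _, rfl⟩
  · exact Submodule.subset_span ⟨.inr _, rfl⟩

end IsWienerIntegral

end Wiener

/-! ### Bochner integrals in L² as pathwise integrals. -/

section LpFubini

variable {Ω : Type*} [mΩ : MeasurableSpace Ω] {P : Measure Ω} [IsProbabilityMeasure P]
  {μ : Measure ℝ} [SFinite μ] {f : Ω × ℝ → ℝ} {F : ℝ → Lp ℝ 2 P}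

lemma integral_norm_le_norm_Lp (x : Lp ℝ 2 P) : ∫ ω, ‖x ω‖ ∂P ≤ ‖x‖ := by
  rw [integral_norm_eq_lintegral_enorm (Lp.aestronglyMeasurable x), Lp.norm_def,
    ← eLpNorm_one_eq_lintegral_enorm]
  exact ENNReal.toReal_mono (Lp.eLpNorm_ne_top x)
    (eLpNorm_le_eLpNorm_of_exponent_le (by norm_num) (Lp.aestronglyMeasurable x))

/-- A jointly measurable process that represents an integrable curve in `L²` is integrable in the
product space. -/
lemma integrable_prod_of_integrable_Lp (hf : StronglyMeasurable f) (hF : Integrable F μ)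
    (h : ∀ᵐ r ∂μ, F r =ᵐ[P] fun ω ↦ f (ω, r)) : Integrable f (P.prod μ) := by
  rw [integrable_prod_iff' hf.aestronglyMeasurable]
  refine ⟨?_, hF.norm.mono ?_ ?_⟩
  · filter_upwards [h] with r hr
    exact ((Lp.memLp (F r)).integrable (by norm_num)).congr hr
  · exact (hf.norm.integral_prod_left' (μ := P)).aestronglyMeasurable
  · filter_upwards [h] with r hr
    rw [norm_norm, Real.norm_of_nonneg (integral_nonneg fun _ ↦ norm_nonneg _)]
    refine le_trans (le_of_eq ?_) (integral_norm_le_norm_Lp (F r))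
    refine integral_congr_ae ?_
    filter_upwards [hr] with ω hω
    rw [hω]

/-- The Bochner integral of a curve in `L²` is the pathwise integral. -/
lemma coeFn_integral_Lp (hf : StronglyMeasurable f) (hF : Integrable F μ)
    (h : ∀ᵐ r ∂μ, F r =ᵐ[P] fun ω ↦ f (ω, r)) :
    (∫ r, F r ∂μ : Lp ℝ 2 P) =ᵐ[P] fun ω ↦ ∫ r, f (ω, r) ∂μ := by
  have hint := integrable_prod_of_integrable_Lp hf hF h
  refine Integrable.ae_eq_of_forall_setIntegral_eq _ _ ((Lp.memLp _).integrable (by norm_num))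
    hint.integral_prod_left fun S hS hPS ↦ ?_
  -- Both functions are tested on an event S. Integration over S is the inner product with its
  -- indicator, which commutes with the Bochner integral; Fubini does the same for the pathwise
  -- integral.
  have hswap : ∫ ω in S, ∫ r, f (ω, r) ∂μ ∂P = ∫ r, ∫ ω in S, f (ω, r) ∂P ∂μ := by
    refine integral_integral_swap (f := fun ω r ↦ f (ω, r)) (hint.mono_measure ?_)
    exact Measure.prod_mono Measure.restrict_le_self le_rfl
  rw [hswap, ← L2.inner_indicatorConstLp_one (𝕜 := ℝ) hS hPS.ne, ← innerSL_apply_apply ℝ,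
    ← ContinuousLinearMap.integral_comp_comm _ hF]
  refine integral_congr_ae ?_
  filter_upwards [h] with r hr
  rw [innerSL_apply_apply, L2.inner_indicatorConstLp_one]
  exact integral_congr_ae (ae_restrict_of_ae hr)

end LpFubini

/-! ### Measurability of the drift and of its integral. -/

section Compensator

variable {Ω : Type*} {T : ℝ}

/-- The drift rate of `B` on the set of paths outside of `N`, and zero on `N`. -/
noncomputable def pathDrift (hT : 0 < T) (σ : ℝ → ℝ) (B V : Time T → Ω → ℝ) (N : Set Ω)
    (p : Ω × ℝ) : ℝ :=
  Nᶜ.indicator (fun ω ↦ V (Set.projIcc 0 T hT.le p.2) ω - B (Set.projIcc 0 T hT.le p.2) ω) p.1 /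
    signalVar T σ (Set.projIcc 0 T hT.le p.2)

/-- The integrated drift. -/
noncomputable def compensator (hT : 0 < T) (σ : ℝ → ℝ) (B V : Time T → Ω → ℝ) (N : Set Ω)
    (t : Time T) (ω : Ω) : ℝ :=
  ∫ r in (0 : ℝ)..t, pathDrift hT σ B V N (ω, r)

lemma pathDrift_eq_driftRate (hT : 0 < T) (σ : ℝ → ℝ) (B V : Time T → Ω → ℝ) {N : Set Ω} {ω : Ω}
    (hω : ω ∉ N) {r : ℝ} (hr : r ∈ Set.Icc 0 T) :
    pathDrift hT σ B V N (ω, r) = driftRate hT σ (fun s ↦ V s ω) (fun s ↦ B s ω) r := by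
  rw [pathDrift, driftRate, Set.indicator_of_mem hω, Set.projIcc_of_mem hT.le hr]
  simp only [Set.IccExtend, Function.comp_apply, Set.projIcc_of_mem hT.le hr]

lemma integrableOn_sq {σ : ℝ → ℝ} (hσ : MemLp σ 2 (volume.restrict (Set.Icc 0 T))) :
    IntegrableOn (fun u ↦ σ u ^ 2) (Set.Icc 0 T) :=
  hσ.integrable_sq

lemma intervalIntegrable_sq {σ : ℝ → ℝ} (hσ : MemLp σ 2 (volume.restrict (Set.Icc 0 T)))
    {s t : ℝ} (hs : s ∈ Set.Icc 0 T) (ht : t ∈ Set.Icc 0 T) :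
    IntervalIntegrable (fun u ↦ σ u ^ 2) volume s t := by
  have h : IntervalIntegrable (fun u ↦ σ u ^ 2) volume 0 T := by
    rw [intervalIntegrable_iff_integrableOn_Icc_of_le (hs.1.trans hs.2)]
    exact integrableOn_sq hσ
  refine h.mono_set ?_
  rw [Set.uIcc_of_le (hs.1.trans hs.2)]
  exact Set.uIcc_subset_Icc hs ht

lemma continuousOn_remainingVar (hT : 0 < T) {σ : ℝ → ℝ}
    (hσ : MemLp σ 2 (volume.restrict (Set.Icc 0 T))) :
    ContinuousOn (fun s ↦ ∫ u in s..T, σ u ^ 2) (Set.Icc 0 T) := by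
  have h1 := intervalIntegral.continuousOn_primitive_interval (a := T) (b := 0) (μ := volume)
    (f := fun u ↦ σ u ^ 2) (by rw [Set.uIcc_of_ge hT.le]; exact integrableOn_sq hσ)
  rw [Set.uIcc_of_ge hT.le] at h1
  refine h1.neg.congr fun s _ ↦ ?_
  rw [intervalIntegral.integral_symm]
  rfl

lemma measurable_signalVar_projIcc (hT : 0 < T) {σ : ℝ → ℝ}
    (hσ : MemLp σ 2 (volume.restrict (Set.Icc 0 T))) :
    Measurable fun r ↦ signalVar T σ (Set.projIcc 0 T hT.le r) := by
  have h1 : ContinuousOn (signalVar T σ) (Set.Icc 0 T) :=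
    ((continuousOn_remainingVar hT hσ).const_add T).sub continuousOn_id
  have h2 : Continuous fun r ↦ signalVar T σ (Set.projIcc 0 T hT.le r) :=
    h1.comp_continuous (continuous_subtype_val.comp continuous_projIcc) fun r ↦ Subtype.prop _
  exact h2.measurable

variable [m : MeasurableSpace Ω]

/-- With time stopped at `t` only the past enters. The numerator is continuous in time for every ω,
being zero on `N`, and measurable in ω for each time, hence jointly measurable. The σ-algebra on `Ω`
is left arbitrary so that it can be a member of the filtration, which yields adaptedness. -/
lemma measurable_pathDrift_min (hT : 0 < T) {σ : ℝ → ℝ}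
    (hσ : MemLp σ 2 (volume.restrict (Set.Icc 0 T))) {B V : Time T → Ω → ℝ} {N : Set Ω}
    {t : Time T} (hB : ∀ u ≤ t, Measurable (B u)) (hV : ∀ u ≤ t, Measurable (V u))
    (hN : MeasurableSet N)
    (hc : ∀ ω ∉ N, (Continuous fun u ↦ B u ω) ∧ Continuous fun u ↦ V u ω) :
    Measurable fun p : Ω × ℝ ↦ pathDrift hT σ B V N (p.1, min p.2 t) := by
  have hproj : Continuous fun r : ℝ ↦ Set.projIcc 0 T hT.le (min r t) :=
    continuous_projIcc.comp (continuous_id.min continuous_const)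
  have hle : ∀ r : ℝ, Set.projIcc 0 T hT.le (min r t) ≤ t := fun r ↦ by
    refine (Set.monotone_projIcc hT.le (min_le_right r t)).trans (le_of_eq ?_)
    exact Set.projIcc_val hT.le t
  have hnum : Measurable (Function.uncurry fun (r : ℝ) (ω : Ω) ↦
      Nᶜ.indicator (fun ω ↦ V (Set.projIcc 0 T hT.le (min r t)) ω -
        B (Set.projIcc 0 T hT.le (min r t)) ω) ω) := by
    refine measurable_uncurry_of_continuous_of_measurable (fun ω ↦ ?_) fun r ↦ ?_
    · by_cases hω : ω ∈ N
      · simp only [Set.indicator, Set.mem_compl_iff, hω, not_true_eq_false, if_false]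
        exact continuous_const
      · simp only [Set.indicator, Set.mem_compl_iff, hω, not_false_eq_true, if_true]
        exact ((hc ω hω).2.comp hproj).sub ((hc ω hω).1.comp hproj)
    · exact ((hV _ (hle r)).sub (hB _ (hle r))).indicator hN.compl
  exact (hnum.comp measurable_swap).div ((measurable_signalVar_projIcc hT hσ).comp
    (measurable_snd.min measurable_const))

lemma measurable_pathDrift (hT : 0 < T) {σ : ℝ → ℝ}
    (hσ : MemLp σ 2 (volume.restrict (Set.Icc 0 T))) {B V : Time T → Ω → ℝ} {N : Set Ω}
    (hB : ∀ u, Measurable (B u)) (hV : ∀ u, Measurable (V u)) (hN : MeasurableSet N)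
    (hc : ∀ ω ∉ N, (Continuous fun u ↦ B u ω) ∧ Continuous fun u ↦ V u ω) :
    Measurable (pathDrift hT σ B V N) := by
  have h := measurable_pathDrift_min hT hσ (t := finalTime hT) (fun u _ ↦ hB u) (fun u _ ↦ hV u)
    hN hc
  have heq : ∀ r : ℝ, Set.projIcc 0 T hT.le (min r T) = Set.projIcc 0 T hT.le r := fun r ↦ by
    rcases le_total r T with h' | h'
    · rw [min_eq_left h']
    · rw [min_eq_right h', Set.projIcc_of_right_le _ h', Set.projIcc_right]
  convert! h using 2 with p
  simp only [pathDrift, finalTime, heq]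

lemma measurable_compensator (hT : 0 < T) {σ : ℝ → ℝ}
    (hσ : MemLp σ 2 (volume.restrict (Set.Icc 0 T))) {B V : Time T → Ω → ℝ} {N : Set Ω}
    {t : Time T} (hB : ∀ u ≤ t, Measurable (B u)) (hV : ∀ u ≤ t, Measurable (V u))
    (hN : MeasurableSet N)
    (hc : ∀ ω ∉ N, (Continuous fun u ↦ B u ω) ∧ Continuous fun u ↦ V u ω) :
    Measurable (compensator hT σ B V N t) := by
  have h := (measurable_pathDrift_min hT hσ hB hV hN hc).stronglyMeasurable.integral_prod_right'
    (ν := volume.restrict (Set.Ioc 0 (t : ℝ)))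
  convert! h.measurable using 2 with ω
  rw [compensator, intervalIntegral.integral_of_le t.2.1]
  refine setIntegral_congr_fun measurableSet_Ioc fun r hr ↦ ?_
  simp only [min_eq_left hr.2]

end Compensator

/-! ### Continuity and bounded variation of the integrated drift. -/

section PathRegularity

variable {T : ℝ} {f : ℝ → ℝ}

lemma boundedVariationOn_integral (hT : 0 ≤ T) (hf : IntervalIntegrable f volume 0 T) :
    BoundedVariationOn (fun t : Time T ↦ ∫ r in (0 : ℝ)..t, f r) Set.univ := by
  have h1 := (hf.absolutelyContinuousOnInterval_intervalIntegral
    Set.left_mem_uIcc).boundedVariationOn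
  rw [Set.uIcc_of_le hT] at h1
  refine ne_top_of_le_ne_top h1 (eVariationOn.comp_le_of_monotoneOn
    (fun t : ℝ ↦ ∫ r in (0 : ℝ)..t, f r) (fun t : Time T ↦ (t : ℝ)) ?_ ?_)
  · exact fun _ _ _ _ h ↦ h
  · exact fun t _ ↦ t.2

lemma continuous_integral (hT : 0 ≤ T) (hf : IntervalIntegrable f volume 0 T) :
    Continuous fun t : Time T ↦ ∫ r in (0 : ℝ)..t, f r := by
  have h1 := intervalIntegral.continuousOn_primitive_interval (a := 0) (b := T) (μ := volume)
    (f := f) (by rw [Set.uIcc_of_le hT, ← intervalIntegrable_iff_integrableOn_Icc_of_le hT]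
                 exact hf)
  rw [Set.uIcc_of_le hT] at h1
  exact h1.comp_continuous continuous_subtype_val fun t ↦ t.2

end PathRegularity

/-! ### Independence under null events and almost sure limits. -/

section Independence

variable {Ω : Type*} {m m₁ m₂ : MeasurableSpace Ω} [mΩ : MeasurableSpace Ω] {P : Measure Ω}

/-- The sets that agree almost everywhere with a set of `m` form a σ-algebra, which contains `m` and
the null events. -/
lemma exists_ae_eq_of_measurableSet_sup_nullSigma {s : Set Ω}
    (hs : MeasurableSet[m ⊔ nullSigma P] s) : ∃ t, MeasurableSet[m] t ∧ s =ᵐ[P] t := by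
  have hle : m ⊔ nullSigma P ≤ eventuallyMeasurableSpace m (ae P) := by
    refine sup_le le_eventuallyMeasurableSpace (MeasurableSpace.generateFrom_le fun N hN ↦ ?_)
    exact ⟨∅, @MeasurableSet.empty _ m, ae_eq_empty.2 hN.2⟩
  exact hle s hs

lemma indep_sup_nullSigma (h : Indep m₁ m₂ P) : Indep m₁ (m₂ ⊔ nullSigma P) P := by
  rw [Indep_iff] at h ⊢
  intro t₁ t₂ h₁ h₂
  obtain ⟨t, ht, hae⟩ := exists_ae_eq_of_measurableSet_sup_nullSigma h₂
  rw [measure_congr hae, measure_congr ((ae_eq_refl t₁).inter hae), h t₁ t h₁ ht]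

/-- Independence of a σ-algebra is preserved by almost sure limits. -/
lemma indep_comap_of_tendsto [IsProbabilityMeasure P] {Z : ℕ → Ω → ℝ} {Y : Ω → ℝ} (hm : m ≤ mΩ)
    (hZ : ∀ n, Measurable (Z n)) (hY : Measurable Y)
    (h : ∀ n, Indep m (MeasurableSpace.comap (Z n) inferInstance) P)
    (hlim : ∀ᵐ ω ∂P, Tendsto (fun n ↦ Z n ω) atTop (𝓝 (Y ω))) :
    Indep m (MeasurableSpace.comap Y inferInstance) P := by
  refine indep_comap_of_bcf hm hY.aemeasurable fun A hA f ↦ ?_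
  -- Dominated convergence is used twice, for `P` restricted to `A` and for `P` itself, to pass to
  -- the limit in the product formula.
  have hconv : ∀ (ν : Measure Ω) [IsFiniteMeasure ν], ν ≪ P →
      Tendsto (fun n ↦ ∫ ω, f (Z n ω) ∂ν) atTop (𝓝 (∫ ω, f (Y ω) ∂ν)) := fun ν _ hν ↦ by
    refine tendsto_integral_of_dominated_convergence (fun _ ↦ ‖f‖)
      (fun n ↦ (f.continuous.measurable.comp (hZ n)).aestronglyMeasurable) (integrable_const _)
      (fun n ↦ ae_of_all _ fun ω ↦ f.norm_coe_le_norm _) ?_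
    filter_upwards [hν.ae_le hlim] with ω hω
    exact (f.continuous.tendsto _).comp hω
  refine tendsto_nhds_unique (hconv (P.restrict A) Measure.absolutelyContinuous_restrict)
    (((hconv P Measure.AbsolutelyContinuous.rfl).const_mul (P.real A)).congr fun n ↦ ?_)
  exact ((h n).setIntegral_eq_mul hm (hZ n).aemeasurable hA
    f.continuous.aestronglyMeasurable).symm

omit mΩ in
lemma comap_le_comap_pi {S : Type*} (Y : S → Ω → ℝ) (s : S) :
    MeasurableSpace.comap (Y s) inferInstance ≤
      MeasurableSpace.comap (fun ω s ↦ Y s ω) inferInstance := by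
  have h : Y s = (fun y : S → ℝ ↦ y s) ∘ fun ω s ↦ Y s ω := rfl
  rw [h, ← MeasurableSpace.comap_comp]
  exact MeasurableSpace.comap_mono (measurable_pi_apply s).comap_le

end Independence

/-! ### Independence from the augmented right-continuous filtration. -/

section JointFiltration

variable {Ω : Type*} [mΩ : MeasurableSpace Ω] {T : ℝ} {P : Measure Ω} {X Y : Time T → Ω → ℝ}
  (hX : ∀ t, Measurable (X t)) (hY : ∀ t, Measurable (Y t))

/-- The σ-algebra generated by two processes up to time `t` and by the null events. -/
@[reducible] def pastSigma (X Y : Time T → Ω → ℝ) (P : Measure Ω) (t : Time T) : MeasurableSpace Ω :=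
  ((⨆ u, ⨆ (_ : u ≤ t), MeasurableSpace.comap (X u) inferInstance) ⊔
    (⨆ u, ⨆ (_ : u ≤ t), MeasurableSpace.comap (Y u) inferInstance)) ⊔ nullSigma P

include hX hY

lemma pastSigma_le_jointFiltration (t : Time T) :
    pastSigma X Y P t ≤ jointFiltration X Y hX hY P t :=
  (Filtration.natural X (fun t ↦ (hX t).stronglyMeasurable) ⊔
    Filtration.natural Y (fun t ↦ (hY t).stronglyMeasurable) ⊔
    Filtration.const (Time T) (nullSigma P) (nullSigma_le P)).le_rightCont t

lemma jointFiltration_le_pastSigma {s t : Time T} (hst : s < t) :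
    jointFiltration X Y hX hY P s ≤ pastSigma X Y P t := by
  rw [jointFiltration, Filtration.rightCont_eq_of_not_isMax _ (not_isMax_iff.2 ⟨t, hst⟩)]
  exact iInf₂_le t hst

lemma measurable_left_jointFiltration {u t : Time T} (hut : u ≤ t) :
    Measurable[jointFiltration X Y hX hY P t] (X u) := by
  refine Measurable.mono (comap_measurable (X u)) (le_trans ?_ (pastSigma_le_jointFiltration hX hY t))
    le_rfl
  exact (le_iSup₂_of_le (f := fun u (_ : u ≤ t) ↦ MeasurableSpace.comap (X u) inferInstance)
    u hut le_rfl).trans (le_sup_left.trans le_sup_left)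

lemma measurable_right_jointFiltration {u t : Time T} (hut : u ≤ t) :
    Measurable[jointFiltration X Y hX hY P t] (Y u) := by
  refine Measurable.mono (comap_measurable (Y u)) (le_trans ?_ (pastSigma_le_jointFiltration hX hY t))
    le_rfl
  exact (le_iSup₂_of_le (f := fun u (_ : u ≤ t) ↦ MeasurableSpace.comap (Y u) inferInstance)
    u hut le_rfl).trans (le_sup_right.trans le_sup_left)

lemma measurableSet_jointFiltration_of_null {N : Set Ω} (hN : MeasurableSet N) (h0 : P N = 0)
    (t : Time T) : MeasurableSet[jointFiltration X Y hX hY P t] N :=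
  pastSigma_le_jointFiltration hX hY t N
    ((le_sup_right : nullSigma P ≤ pastSigma X Y P t) N
      (MeasurableSpace.measurableSet_generateFrom ⟨hN, h0⟩))

omit hX hY in
/-- A random variable that is orthogonal to two jointly Gaussian processes up to time `t` is
independent of their past. -/
lemma indep_pastSigma_of_inner_eq_zero [IsProbabilityMeasure P] {G : Submodule ℝ (Lp ℝ 2 P)}
    (hG : IsGaussianSpace G)
    {x y : Time T → Lp ℝ 2 P} (hxG : ∀ u, x u ∈ G) (hyG : ∀ u, y u ∈ G)
    (hxX : ∀ u, x u =ᵐ[P] X u) (hyY : ∀ u, y u =ᵐ[P] Y u) {z : Lp ℝ 2 P} (hzG : z ∈ G)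
    {Z : Ω → ℝ} (hzZ : z =ᵐ[P] Z) {t : Time T} (h1 : ∀ u ≤ t, inner ℝ (x u) z = 0)
    (h2 : ∀ u ≤ t, inner ℝ (y u) z = 0) :
    Indep (MeasurableSpace.comap Z inferInstance) (pastSigma X Y P t) P := by
  refine indep_sup_nullSigma ?_
  let K : Set.Iic t ⊕ Set.Iic t → Ω → ℝ := Sum.elim (fun u ↦ X u) (fun u ↦ Y u)
  let k : Set.Iic t ⊕ Set.Iic t → Lp ℝ 2 P := Sum.elim (fun u ↦ x u) (fun u ↦ y u)
  have hind := hG.indepFun (X := fun _ : Unit ↦ Z) (Y := K) (x := fun _ ↦ z) (y := k)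
    (fun _ ↦ hzG) (by rintro (u | u); exacts [hxG u, hyG u]) (fun _ ↦ hzZ)
    (by rintro (u | u); exacts [hxX u, hyY u]) (by
      rintro _ (u | u)
      · rw [real_inner_comm]; exact h1 u u.2
      · rw [real_inner_comm]; exact h2 u u.2)
  rw [IndepFun_iff_Indep] at hind
  refine indep_of_indep_of_le_right (indep_of_indep_of_le_left hind
    (comap_le_comap_pi (fun _ : Unit ↦ Z) ())) (sup_le ?_ ?_)
  · exact iSup₂_le fun u hu ↦ comap_le_comap_pi K (.inl ⟨u, hu⟩)
  · exact iSup₂_le fun u hu ↦ comap_le_comap_pi K (.inr ⟨u, hu⟩)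

/-- A process with almost surely continuous paths whose increments are independent of the past has
increments that are independent of the right-continuous filtration. -/
lemma indep_jointFiltration [IsProbabilityMeasure P] {Z : Time T → Ω → ℝ}
    (hZ : ∀ t, Measurable (Z t)) (hc : ∀ᵐ ω ∂P, Continuous fun t ↦ Z t ω)
    (h : ∀ s t : Time T, s ≤ t →
      Indep (MeasurableSpace.comap (Z t - Z s) inferInstance) (pastSigma X Y P s) P)
    {s t : Time T} (hst : s ≤ t) :
    Indep (MeasurableSpace.comap (Z t - Z s) inferInstance) (jointFiltration X Y hX hY P s) P := by
  rcases hst.lt_or_eq with hst | rfl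
  -- Along times decreasing strictly to s, the right-continuous σ-algebra at s lies in the past of
  -- each `u n`, so it is independent of the increment from `u n` to `t`; path continuity gives the
  -- limit.
  · obtain ⟨u, -, hu, hlim⟩ := exists_seq_strictAnti_tendsto' hst
    refine (indep_comap_of_tendsto (Z := fun n ↦ Z t - Z (u n))
      ((jointFiltration X Y hX hY P).le s) (fun n ↦ (hZ t).sub (hZ _)) ((hZ t).sub (hZ s))
      (fun n ↦ ?_) ?_).symm
    · exact (indep_of_indep_of_le_right (h (u n) t (hu n).2.le)
        (jointFiltration_le_pastSigma hX hY (hu n).1)).symm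
    · filter_upwards [hc] with ω hω
      exact tendsto_const_nhds.sub ((hω.tendsto s).comp hlim)
  -- This case includes s = T, which has no later times; the increment is zero.
  · rw [sub_self]
    have : (0 : Ω → ℝ) = fun _ ↦ (0 : ℝ) := rfl
    rw [this, MeasurableSpace.comap_const]
    exact indep_bot_left _

end JointFiltration

/-! ### Martingale property and auxiliary facts on closed subspaces and remaining variance. -/

section Martingale

variable {Ω : Type*} [mΩ : MeasurableSpace Ω] {T : ℝ} {P : Measure Ω} [IsProbabilityMeasure P]

lemma IsBrownianMotionWrt.martingale {𝓖 : Filtration (Time T) mΩ} {X : Time T → Ω → ℝ}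
    (hX : IsBrownianMotionWrt 𝓖 X P) : Martingale X 𝓖 P := by
  have hint : ∀ t, Integrable (X t) P := fun t ↦
    (hX.toIsBrownianMotion.memLp t).integrable (by norm_num)
  refine ⟨fun t ↦ (hX.adapted t).stronglyMeasurable, fun s t hst ↦ ?_⟩
  have h1 : P[X s | 𝓖 s] = X s :=
    condExp_of_stronglyMeasurable (𝓖.le s) (hX.adapted s).stronglyMeasurable (hint s)
  have h2 : P[X t - X s | 𝓖 s] =ᵐ[P] fun _ ↦ ∫ ω, (X t - X s) ω ∂P :=
    condExp_indep_eq ((hX.measurable t).sub (hX.measurable s)).comap_le (𝓖.le s)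
      (comap_measurable (X t - X s)).stronglyMeasurable (hX.indep s t hst)
  have h3 : ∫ ω, (X t - X s) ω ∂P = 0 := by
    rw [(hX.hasLaw_sub s t hst).integral_eq, integral_id_gaussianReal]
  have h4 : X t = X s + (X t - X s) := by abel
  rw [h4]
  filter_upwards [condExp_add (hint s) ((hint t).sub (hint s)) (𝓖 s), h2] with ω h5 h6
  rw [h5, Pi.add_apply, h1, h6, h3, add_zero]

end Martingale

/-- A closed subspace is its own double orthogonal complement, and the inner product with a fixed
vector commutes with the integral. -/
lemma intervalIntegral_mem_of_isClosed {H : Type*} [NormedAddCommGroup H] [InnerProductSpace ℝ H]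
    [CompleteSpace H] {G : Submodule ℝ H} (hG : IsClosed (G : Set H)) {F : ℝ → H} {a b : ℝ}
    (hF : IntervalIntegrable F volume a b) (h : ∀ r, F r ∈ G) : ∫ r in a..b, F r ∈ G := by
  have : CompleteSpace G := hG.completeSpace_coe
  rw [← Submodule.orthogonal_orthogonal G, Submodule.mem_orthogonal]
  intro z hz
  have h1 := (innerSL ℝ z).intervalIntegral_comp_comm hF
  simp only [innerSL_apply_apply] at h1
  rw [← h1]
  have h2 : ∀ r, inner ℝ z (F r) = 0 := fun r ↦ Submodule.inner_left_of_mem_orthogonal (h r) hz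
  simp [h2]

lemma remainingVar_sub {T : ℝ} {σ : ℝ → ℝ} (hσ : MemLp σ 2 (volume.restrict (Set.Icc 0 T)))
    {s t : ℝ} (hs : s ∈ Set.Icc 0 T) (ht : t ∈ Set.Icc 0 T) :
    (∫ u in s..T, σ u ^ 2) - ∫ u in t..T, σ u ^ 2 = ∫ u in s..t, σ u ^ 2 := by
  have hT : T ∈ Set.Icc 0 T := ⟨hs.1.trans hs.2, le_rfl⟩
  rw [← intervalIntegral.integral_add_adjacent_intervals (intervalIntegrable_sq hσ hs ht)
    (intervalIntegrable_sq hσ ht hT), add_sub_cancel_right]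

/-- The gap is the integral of σ² over [0, s], which vanishes only if σ does almost everywhere. -/
lemma remainingVar_lt {T : ℝ} {σ : ℝ → ℝ} (hσ : MemLp σ 2 (volume.restrict (Set.Icc 0 T)))
    {s : ℝ} (hs : s ∈ Set.Icc 0 T)
    (hne : ¬ ∀ᵐ u ∂(volume.restrict (Set.Icc 0 s)), σ u = 0) :
    ∫ u in s..T, σ u ^ 2 < ∫ u in (0 : ℝ)..T, σ u ^ 2 := by
  have h0 : (0 : ℝ) ∈ Set.Icc 0 T := ⟨le_rfl, hs.1.trans hs.2⟩
  rw [← sub_pos, remainingVar_sub hσ h0 hs, intervalIntegral.integral_of_le hs.1,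
    ← integral_Icc_eq_integral_Ioc]
  refine lt_of_le_of_ne (integral_nonneg fun u ↦ sq_nonneg _) fun h ↦ hne ?_
  have h1 := (setIntegral_eq_zero_iff_of_nonneg_ae (ae_of_all _ fun u ↦ sq_nonneg (σ u))
    ((integrableOn_sq hσ).mono_set (Set.Icc_subset_Icc_right hs.2))).1 h.symm
  filter_upwards [h1] with u hu
  simpa using hu

lemma remainingVar_eq_zero {T : ℝ} {σ : ℝ → ℝ} (hT : 0 ≤ T)
    (h : ∀ᵐ u ∂(volume.restrict (Set.Icc 0 T)), σ u = 0) :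
    ∫ u in (0 : ℝ)..T, σ u ^ 2 = 0 := by
  rw [intervalIntegral.integral_of_le hT, ← integral_Icc_eq_integral_Ioc]
  refine integral_eq_zero_of_ae ?_
  filter_upwards [h] with u hu
  simp [hu]

/-! ### The covariances of the signal. -/

section Signal

variable {Ω : Type*} [mΩ : MeasurableSpace Ω] {P : Measure Ω} {T : ℝ} {hT : 0 < T}
  {B W V : Time T → Ω → ℝ} {σ : ℝ → ℝ}

namespace IsBackwardWienerProcess

variable (hB : IsBrownianMotion B P)
  (hV : IsBackwardWienerProcess W P σ (B (finalTime hT)) V)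

/-- The signal at time `t`, as an element of `L²(P)`. -/
noncomputable def vec (t : Time T) : Lp ℝ 2 P :=
  hB.vec (finalTime hT) + (hV.isWienerIntegral t).1.toLp

lemma coeFn_vec (t : Time T) : hV.vec hB t =ᵐ[P] V t := by
  filter_upwards [Lp.coeFn_add (hB.vec (finalTime hT)) (hV.isWienerIntegral t).1.toLp,
    hB.coeFn_vec (finalTime hT), (hV.isWienerIntegral t).1.coeFn_toLp] with ω h1 h2 h3
  rw [vec, h1, Pi.add_apply, h2, h3]
  ring

/-- The innovation of the signal, as a curve in `L²(P)`. -/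
noncomputable def innovationVec (t : Time T) : Lp ℝ 2 P :=
  innovation T (fun s ↦ ∫ u in s..T, σ u ^ 2) (fun s ↦ hB.vec (Set.projIcc 0 T hT.le s))
    (fun s ↦ hV.vec hB (Set.projIcc 0 T hT.le s)) t

variable (hW : IsBrownianMotion W P)
  (hBW : IndepFun (fun ω t ↦ B t ω) (fun ω t ↦ W t ω) P)
  (hσ : MemLp σ 2 (volume.restrict (Set.Icc 0 T)))
include hW hσ

lemma vec_mem_gaussianSpace (t : Time T) : hV.vec hB t ∈ gaussianSpace hB hW :=
  Submodule.add_mem _ (vec_left_mem_gaussianSpace hB hW _)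
    ((hV.isWienerIntegral t).toLp_mem_gaussianSpace hB hW (hσ.indicator measurableSet_Ioc))

include hBW

lemma inner_brownian_vec (s t : Time T) : inner ℝ (hB.vec s) (hV.vec hB t) = s := by
  rw [vec, inner_add_right, hB.inner_vec, (hV.isWienerIntegral t).inner_vec_toLp hB hW hBW
    (hσ.indicator measurableSet_Ioc), add_zero]
  exact min_eq_left s.2.2

lemma inner_vec_vec {s t : Time T} (hst : s ≤ t) :
    inner ℝ (hV.vec hB s) (hV.vec hB t) = T + ∫ u in (t : ℝ)..T, σ u ^ 2 := by
  have hs := hσ.indicator (s := Set.Ioc (s : ℝ) T) measurableSet_Ioc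
  have ht := hσ.indicator (s := Set.Ioc (t : ℝ) T) measurableSet_Ioc
  have hvs : hV.vec hB s = hB.vec (finalTime hT) + (hV.isWienerIntegral s).1.toLp := rfl
  rw [hvs, inner_add_left, hV.inner_brownian_vec hB hW hBW hσ, vec, inner_add_right,
    real_inner_comm, (hV.isWienerIntegral s).inner_vec_toLp hB hW hBW hs, zero_add,
    (hV.isWienerIntegral s).inner_toLp hW (hV.isWienerIntegral t) hs ht]
  congr 1
  rw [intervalIntegral.integral_of_le t.2.2]
  have hprod : ∀ u, (Set.Ioc (s : ℝ) T).indicator σ u * (Set.Ioc (t : ℝ) T).indicator σ u =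
      (Set.Ioc (t : ℝ) T).indicator (fun u ↦ σ u ^ 2) u := fun u ↦ by
    by_cases hu : u ∈ Set.Ioc (t : ℝ) T
    · have hu' : u ∈ Set.Ioc (s : ℝ) T := ⟨lt_of_le_of_lt hst hu.1, hu.2⟩
      rw [Set.indicator_of_mem hu, Set.indicator_of_mem hu, Set.indicator_of_mem hu', pow_two]
    · rw [Set.indicator_of_notMem hu, Set.indicator_of_notMem hu, mul_zero]
  simp_rw [hprod]
  rw [setIntegral_indicator measurableSet_Ioc, Set.inter_eq_right.2]
  exact fun u hu ↦ ⟨t.2.1.trans hu.1.le, hu.2⟩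

/-- This connects the processes to the Hilbert space computation. Extending the curves by
`Set.projIcc` only serves to define them on all of ℝ. -/
lemma isSignalPair : IsSignalPair T (fun s ↦ ∫ u in s..T, σ u ^ 2)
    (fun s ↦ hB.vec (Set.projIcc 0 T hT.le s)) (fun s ↦ hV.vec hB (Set.projIcc 0 T hT.le s)) where
  pos := hT
  continuousOn := continuousOn_remainingVar hT hσ
  antitoneOn s hs t ht hst := by
    rw [← sub_nonneg, remainingVar_sub hσ hs ht]
    exact intervalIntegral.integral_nonneg hst fun u _ ↦ sq_nonneg _
  final := intervalIntegral.integral_same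
  inner_b_b s hs t ht hst := by
    rw [hB.inner_vec, Set.projIcc_of_mem hT.le hs, Set.projIcc_of_mem hT.le ht]
    exact min_eq_left hst
  inner_b_v s hs t ht := by
    rw [hV.inner_brownian_vec hB hW hBW hσ, Set.projIcc_of_mem hT.le hs]
  inner_v_v s hs t ht hst := by
    rw [hV.inner_vec_vec hB hW hBW hσ (Set.monotone_projIcc hT.le hst),
      Set.projIcc_of_mem hT.le ht]

end IsBackwardWienerProcess

end Signal

/-! ### The innovation process and the decomposition. -/

section Innovation

variable {Ω : Type*} [mΩ : MeasurableSpace Ω] {P : Measure Ω} {T : ℝ} {hT : 0 < T}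
  {B W V : Time T → Ω → ℝ} {σ : ℝ → ℝ} {N : Set Ω}

namespace IsBackwardWienerProcess

variable (hB : IsBrownianMotion B P)
  (hV : IsBackwardWienerProcess W P σ (B (finalTime hT)) V)

include hB hV in
lemma exists_null_set_continuous : ∃ N, MeasurableSet N ∧ P N = 0 ∧
    ∀ ω ∉ N, (Continuous fun u ↦ B u ω) ∧ Continuous fun u ↦ V u ω := by
  have h : ∀ᵐ ω ∂P, (Continuous fun u ↦ B u ω) ∧ Continuous fun u ↦ V u ω :=
    hB.continuous.and hV.continuous
  obtain ⟨N, hN1, hN2, hN3⟩ := exists_measurable_superset_of_null h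
  exact ⟨N, hN2, hN3, fun ω hω ↦ by_contra fun h' ↦ hω (hN1 h')⟩

/-- The curve of drift rates in `L²(P)`. -/
noncomputable def driftVec (r : ℝ) : Lp ℝ 2 P :=
  hilbertDrift T (fun s ↦ ∫ u in s..T, σ u ^ 2) (fun s ↦ hB.vec (Set.projIcc 0 T hT.le s))
    (fun s ↦ hV.vec hB (Set.projIcc 0 T hT.le s)) r

lemma coeFn_driftVec (h0 : P N = 0) {r : ℝ} (hr : r ∈ Set.Icc 0 T) :
    hV.driftVec hB r =ᵐ[P] fun ω ↦ pathDrift hT σ B V N (ω, r) := by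
  have hN : ∀ᵐ ω ∂P, ω ∉ N := measure_eq_zero_iff_ae_notMem.1 h0
  filter_upwards [hN, hB.coeFn_vec (Set.projIcc 0 T hT.le r),
    hV.coeFn_vec hB (Set.projIcc 0 T hT.le r),
    Lp.coeFn_sub (hV.vec hB (Set.projIcc 0 T hT.le r)) (hB.vec (Set.projIcc 0 T hT.le r)),
    Lp.coeFn_smul (T + (∫ u in r..T, σ u ^ 2) - r)⁻¹
      (hV.vec hB (Set.projIcc 0 T hT.le r) - hB.vec (Set.projIcc 0 T hT.le r))]
    with ω h1 h2 h3 h4 h5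
  rw [driftVec, hilbertDrift, h5, Pi.smul_apply, h4, Pi.sub_apply, h2, h3, pathDrift,
    Set.indicator_of_mem (show ω ∈ Nᶜ from h1), smul_eq_mul, signalVar,
    Set.projIcc_of_mem hT.le hr]
  ring

variable (hW : IsBrownianMotion W P)
  (hBW : IndepFun (fun ω t ↦ B t ω) (fun ω t ↦ W t ω) P)
  (hσ : MemLp σ 2 (volume.restrict (Set.Icc 0 T)))

include hB hV hW hBW hσ

lemma intervalIntegrable_driftVec {s t : ℝ} (hs : s ∈ Set.Icc 0 T) (ht : t ∈ Set.Icc 0 T) :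
    IntervalIntegrable (hV.driftVec hB) volume s t :=
  (hV.isSignalPair hB hW hBW hσ).intervalIntegrable_drift hs ht

/-- The integrated drift is not a finite combination of values of `B` and `W`; this is why the
Gaussian space has to be closed. -/
lemma innovationVec_mem_gaussianSpace (t : Time T) :
    hV.innovationVec hB t ∈ gaussianSpace hB hW := by
  refine Submodule.sub_mem _ (vec_left_mem_gaussianSpace hB hW _)
    (intervalIntegral_mem_of_isClosed (Submodule.isClosed_topologicalClosure _)
      (hV.intervalIntegrable_driftVec hB hW hBW hσ ⟨le_rfl, hT.le⟩ t.2) fun r ↦ ?_)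
  exact Submodule.smul_mem _ _ (Submodule.sub_mem _ (hV.vec_mem_gaussianSpace hB hW hσ _)
    (vec_left_mem_gaussianSpace hB hW _))

variable [IsProbabilityMeasure P] (hN : MeasurableSet N) (h0 : P N = 0)
  (hc : ∀ ω ∉ N, (Continuous fun u ↦ B u ω) ∧ Continuous fun u ↦ V u ω)
include hN h0 hc

/-- Integrability of the curve in L² up to the final time gives integrability on the product space,
and Fubini then gives it for almost every path. -/
lemma ae_intervalIntegrable_pathDrift :
    ∀ᵐ ω ∂P, IntervalIntegrable (fun r ↦ pathDrift hT σ B V N (ω, r)) volume 0 T := by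
  have h1 := hV.intervalIntegrable_driftVec hB hW hBW hσ (Set.left_mem_Icc.2 hT.le)
    (Set.right_mem_Icc.2 hT.le)
  rw [intervalIntegrable_iff_integrableOn_Ioc_of_le hT.le] at h1
  have h2 := integrable_prod_of_integrable_Lp
    (measurable_pathDrift hT hσ hB.measurable hV.measurable hN hc).stronglyMeasurable h1
    (by filter_upwards [ae_restrict_mem measurableSet_Ioc] with r hr
        exact hV.coeFn_driftVec hB h0 ⟨hr.1.le, hr.2⟩)
  filter_upwards [h2.prod_right_ae] with ω hω
  rwa [intervalIntegrable_iff_integrableOn_Ioc_of_le hT.le]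

lemma coeFn_innovationVec (t : Time T) :
    hV.innovationVec hB t =ᵐ[P] fun ω ↦ B t ω - compensator hT σ B V N t ω := by
  have h1 := hV.intervalIntegrable_driftVec hB hW hBW hσ (Set.left_mem_Icc.2 hT.le) t.2
  rw [intervalIntegrable_iff_integrableOn_Ioc_of_le t.2.1] at h1
  have h2 := coeFn_integral_Lp
    (measurable_pathDrift hT hσ hB.measurable hV.measurable hN hc).stronglyMeasurable h1
    (by filter_upwards [ae_restrict_mem measurableSet_Ioc] with r hr
        exact hV.coeFn_driftVec hB h0 ⟨hr.1.le, hr.2.trans t.2.2⟩)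
  rw [← intervalIntegral.integral_of_le t.2.1] at h2
  filter_upwards [h2, hB.coeFn_vec t,
    Lp.coeFn_sub (hB.vec t) (∫ r in (0 : ℝ)..t, hV.driftVec hB r)] with ω h3 h4 h5
  have h6 : hV.innovationVec hB t = hB.vec t - ∫ r in (0 : ℝ)..t, hV.driftVec hB r := by
    rw [innovationVec, innovation, Set.projIcc_val]
    rfl
  rw [h6, h5, Pi.sub_apply, h4, h3, compensator, intervalIntegral.integral_of_le t.2.1]

lemma ae_continuous_compensator :
    ∀ᵐ ω ∂P, Continuous fun t ↦ compensator hT σ B V N t ω := by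
  filter_upwards [hV.ae_intervalIntegrable_pathDrift hB hW hBW hσ hN h0 hc] with ω hω
  exact continuous_integral hT.le hω

/-- The innovation is a Brownian motion in the filtration generated by `B` and the signal. -/
lemma isBrownianMotionWrt_innovation :
    IsBrownianMotionWrt (jointFiltration B V hB.measurable hV.measurable P)
      (fun t ω ↦ B t ω - compensator hT σ B V N t ω) P := by
  have hS := hV.isSignalPair hB hW hBW hσ
  have hG := isGaussianSpace_gaussianSpace hT.le hB hW hBW
  have hmem := hV.innovationVec_mem_gaussianSpace hB hW hBW hσ
  have hrep := hV.coeFn_innovationVec hB hW hBW hσ hN h0 hc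
  have hmeas : ∀ t, Measurable fun ω ↦ B t ω - compensator hT σ B V N t ω := fun t ↦
    (hB.measurable t).sub (measurable_compensator hT hσ (fun u _ ↦ hB.measurable u)
      (fun u _ ↦ hV.measurable u) hN hc)
  have hcont : ∀ᵐ ω ∂P, Continuous fun t ↦ B t ω - compensator hT σ B V N t ω := by
    filter_upwards [hB.continuous, hV.ae_continuous_compensator hB hW hBW hσ hN h0 hc]
      with ω h1 h2
    exact h1.sub h2
  have hsub : ∀ s t, (hV.innovationVec hB t - hV.innovationVec hB s : Lp ℝ 2 P) =ᵐ[P]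
      (fun ω ↦ B t ω - compensator hT σ B V N t ω) -
        fun ω ↦ B s ω - compensator hT σ B V N s ω := fun s t ↦
    (Lp.coeFn_sub _ _).trans ((hrep t).sub (hrep s))
  refine ⟨⟨hmeas, fun t ht ↦ ?_, hG.hasIndepIncrements hmem hrep fun r s t u hrs hst htu ↦ ?_,
    fun s t hst ↦ ?_, hcont⟩, fun t ↦ ?_, fun s t hst ↦ ?_⟩
  · filter_upwards [hB.zero t ht] with ω hω
    rw [hω, compensator, ht, intervalIntegral.integral_same, sub_zero]
  · rw [inner_sub_left, innovationVec, innovationVec, innovationVec, innovationVec,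
      hS.inner_innovation_innovation_sub s.2 u.2 hst htu,
      hS.inner_innovation_innovation_sub r.2 u.2 (hrs.trans hst) htu, sub_zero]
  · exact hG.hasLaw (Submodule.sub_mem _ (hmem t) (hmem s)) (hsub s t)
      (hS.inner_innovation_sub_self s.2 t.2 hst)
  -- Adaptedness uses that the null set `N` belongs to every σ-algebra of the filtration.
  · refine (measurable_left_jointFiltration _ _ le_rfl).sub (measurable_compensator
      (m := jointFiltration B V hB.measurable hV.measurable P t) hT hσ
      (fun u hu ↦ measurable_left_jointFiltration _ _ hu)
      (fun u hu ↦ measurable_right_jointFiltration _ _ hu)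
      (measurableSet_jointFiltration_of_null _ _ hN h0 t) hc)
  · refine indep_jointFiltration hB.measurable hV.measurable hmeas hcont (fun s t hst ↦ ?_) hst
    refine indep_pastSigma_of_inner_eq_zero hG (vec_left_mem_gaussianSpace hB hW)
      (hV.vec_mem_gaussianSpace hB hW hσ) hB.coeFn_vec (hV.coeFn_vec hB)
      (Submodule.sub_mem _ (hmem t) (hmem s)) (hsub s t) (fun u hu ↦ ?_) fun u hu ↦ ?_
    · have := hS.inner_b_innovation_sub u.2 t.2 hu hst
      rwa [Set.projIcc_val] at this
    · have := hS.inner_v_innovation_sub u.2 t.2 hu hst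
      rwa [Set.projIcc_val] at this

/-- The integrated drift is the compensator of `B`. -/
lemma isDoobMeyerDecomposition_innovation :
    IsDoobMeyerDecomposition (jointFiltration B V hB.measurable hV.measurable P) P B
      (fun t ω ↦ B t ω - compensator hT σ B V N t ω) (compensator hT σ B V N) where
  eq_add := ae_of_all _ fun ω t ↦ by ring
  martingale := (hV.isBrownianMotionWrt_innovation hB hW hBW hσ hN h0 hc).martingale
  continuous_martingale := (hV.isBrownianMotionWrt_innovation hB hW hBW hσ hN h0 hc).continuous
  adapted t := measurable_compensator
    (m := jointFiltration B V hB.measurable hV.measurable P t) hT hσ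
    (fun u hu ↦ measurable_left_jointFiltration _ _ hu)
    (fun u hu ↦ measurable_right_jointFiltration _ _ hu)
    (measurableSet_jointFiltration_of_null _ _ hN h0 t) hc
  continuous := hV.ae_continuous_compensator hB hW hBW hσ hN h0 hc
  zero t ht := ae_of_all _ fun ω ↦ by rw [compensator, ht, intervalIntegral.integral_same]
  boundedVariation := by
    filter_upwards [hV.ae_intervalIntegrable_pathDrift hB hW hBW hσ hN h0 hc] with ω hω
    exact boundedVariationOn_integral hT.le hω

lemma ae_compensator_eq_integral_driftRate :
    ∀ᵐ ω ∂P, ∀ t : Time T,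
      IntervalIntegrable (driftRate hT σ (fun s ↦ V s ω) (fun s ↦ B s ω)) volume 0 (t : ℝ) ∧
      compensator hT σ B V N t ω =
        ∫ s in (0 : ℝ)..t, driftRate hT σ (fun s ↦ V s ω) (fun s ↦ B s ω) s := by
  filter_upwards [hV.ae_intervalIntegrable_pathDrift hB hW hBW hσ hN h0 hc,
    measure_eq_zero_iff_ae_notMem.1 h0] with ω hω hωN t
  have heq : Set.EqOn (fun r ↦ pathDrift hT σ B V N (ω, r))
      (driftRate hT σ (fun s ↦ V s ω) (fun s ↦ B s ω)) (Set.uIcc 0 t) := fun r hr ↦ by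
    rw [Set.uIcc_of_le t.2.1] at hr
    exact pathDrift_eq_driftRate hT σ B V hωN ⟨hr.1, hr.2.trans t.2.2⟩
  refine ⟨(hω.mono_set ?_).congr (heq.mono Set.uIoc_subset_uIcc),
    intervalIntegral.integral_congr heq⟩
  rw [Set.uIcc_of_le t.2.1, Set.uIcc_of_le hT.le]
  exact Set.Icc_subset_Icc_right t.2.2

lemma covariance_innovation_pos {s t : Time T} (hst : s ≤ t)
    (hne : ¬ ∀ᵐ u ∂(volume.restrict (Set.Icc 0 (s : ℝ))), σ u = 0) :
    0 < cov[fun ω ↦ B t ω - compensator hT σ B V N t ω, V s; P] := by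
  rw [(isGaussianSpace_gaussianSpace hT.le hB hW hBW).covariance_eq
    (hV.innovationVec_mem_gaussianSpace hB hW hBW hσ t)
    (hV.coeFn_innovationVec hB hW hBW hσ hN h0 hc t) (hV.coeFn_vec hB s), real_inner_comm]
  have := (hV.isSignalPair hB hW hBW hσ).inner_innovation_v_pos s.2 t.2 hst
    (remainingVar_lt hσ s.2 hne)
  rwa [Set.projIcc_val] at this

lemma indepFun_innovation_final
    (hzero : ∀ᵐ u ∂(volume.restrict (Set.Icc 0 T)), σ u = 0) :
    IndepFun (fun ω t ↦ B t ω - compensator hT σ B V N t ω) (B (finalTime hT)) P := by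
  have h := (isGaussianSpace_gaussianSpace hT.le hB hW hBW).indepFun
    (X := fun t ω ↦ B t ω - compensator hT σ B V N t ω) (Y := fun _ : Unit ↦ B (finalTime hT))
    (hV.innovationVec_mem_gaussianSpace hB hW hBW hσ)
    (fun _ ↦ vec_left_mem_gaussianSpace hB hW (finalTime hT))
    (hV.coeFn_innovationVec hB hW hBW hσ hN h0 hc) (fun _ ↦ hB.coeFn_vec (finalTime hT))
    fun t _ ↦ by
      rw [real_inner_comm]
      have := (hV.isSignalPair hB hW hBW hσ).inner_final_innovation
        (remainingVar_eq_zero hT.le hzero) t.2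
      rwa [Set.projIcc_right] at this
  exact h.comp measurable_id (measurable_pi_apply ())

end IsBackwardWienerProcess

end Innovation

end Enlargement

theorem mainTheorem5 {Ω : Type*} [mΩ : MeasurableSpace Ω] (P : Measure Ω) [IsProbabilityMeasure P]
    (T : ℝ) (hT : 0 < T)
    (B W : Enlargement.Time T → Ω → ℝ)
    (hB : Enlargement.IsBrownianMotion B P) (hW : Enlargement.IsBrownianMotion W P)
    (hBW : IndepFun (fun ω t ↦ B t ω) (fun ω t ↦ W t ω) P)
    (σ : ℝ → ℝ) (hσ : MemLp σ 2 (volume.restrict (Set.Icc 0 T)))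
    (hint : ∀ t : ℝ, 0 ≤ t → t < T →
      IntegrableOn (fun s ↦ T / Enlargement.signalVar T σ s) (Set.Icc 0 t))
    (V : Enlargement.Time T → Ω → ℝ)
    (hV : Enlargement.IsBackwardWienerProcess W P σ (B (Enlargement.finalTime hT)) V) :
    ∃ Wt A : Enlargement.Time T → Ω → ℝ,
      Enlargement.IsDoobMeyerDecomposition
        (Enlargement.jointFiltration B V hB.measurable hV.measurable P) P B Wt A ∧
      Enlargement.IsBrownianMotionWrt
        (Enlargement.jointFiltration B V hB.measurable hV.measurable P) Wt P ∧
      (∀ᵐ ω ∂P, ∀ t : Enlargement.Time T,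
        IntervalIntegrable (Enlargement.driftRate hT σ (fun s ↦ V s ω) (fun s ↦ B s ω))
          volume 0 (t : ℝ) ∧
        A t ω = ∫ s in (0 : ℝ)..t,
          Enlargement.driftRate hT σ (fun s ↦ V s ω) (fun s ↦ B s ω) s) ∧
      (∀ s t : Enlargement.Time T, s ≤ t →
        ¬ (∀ᵐ u ∂(volume.restrict (Set.Icc 0 (s : ℝ))), σ u = 0) →
        0 < cov[Wt t, V s; P]) ∧
      ((∀ᵐ u ∂(volume.restrict (Set.Icc 0 T)), σ u = 0) →
        IndepFun (fun ω t ↦ Wt t ω) (B (Enlargement.finalTime hT)) P) := by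
  -- Setting the drift to zero on one null set, outside which all paths are continuous, makes the
  -- integrated drift adapted as a function, not merely up to modification.
  obtain ⟨N, hN, h0, hc⟩ := hV.exists_null_set_continuous hB
  exact ⟨fun t ω ↦ B t ω - Enlargement.compensator hT σ B V N t ω,
    Enlargement.compensator hT σ B V N,
    hV.isDoobMeyerDecomposition_innovation hB hW hBW hσ hN h0 hc,
    hV.isBrownianMotionWrt_innovation hB hW hBW hσ hN h0 hc,
    hV.ae_compensator_eq_integral_driftRate hB hW hBW hσ hN h0 hc,
    fun s t hst hne ↦ hV.covariance_innovation_pos hB hW hBW hσ hN h0 hc hst hne,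
    hV.indepFun_innovation_final hB hW hBW hσ hN h0 hc⟩
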